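/- Let $\mathscr C$ be a semimonoidal category (a category with a tensor product functor $\otimes:\mathscr C\times\mathscr C\to\mathscr C$ that is associative, strictly or up to a natural isomorphism satisfying the pentagon equation; no unit is required), and let $b_0<b_1$ be real numbers. A progressive plane graph between the levels $b_0$ and $b_1$ is a finite graph $\Gamma$ with boundary (a distinguished set of vertices of degree one; the other vertices are called nodes), together with an embedding $f:\Gamma\to\mathbb R\times[b_0,b_1]$ such that the points of $\Gamma$ mapped into $\mathbb R\times\{b_0,b_1\}$ are exactly the boundary vertices, and such that the projection to $[b_0,b_1]$ is injective on each edge. Edges are directed upwards; a node has valence $(p,q)$ if it has $p$ input (incoming) and $q$ output (outgoing) edges, and both sets are ordered from left to right. A progressive plane diagram in $\mathscr C$ is such a graph whose edges are labelled by objects and whose nodes are labelled by arrows of $\mathscr C$, such that the source (target) of the label of a node is the tensor product, from left to right, of the labels of its input (output) edges (bracketed from the left if $\otimes$ is not strict). It is effective if $\Gamma$ is non-empty and every node has at least one input edge and at least one output edge. It is a train track diagram if $\Gamma$ is non-empty and every node has valence $(1,1)$, $(2,1)$ or $(1,2)$; then it is effective. Let $X_{\mathscr C}$ be the space of all effective diagrams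 in $\mathscr C$ between $b_0$ and $b_1$, that is, the topological sum, over all labelled finite graphs $\Gamma$, of the sets of embeddings $f$ that make $\Gamma$ an effective diagram, with the compact-open topology. A deformation between two diagrams with the same labelled graph $\Gamma$ is a continuous map $h:\Gamma\times[0,1]\to\mathbb R\times[b_0,b_1]$ from one to the other such that each $h(-,t)$ is a diagram with this labelled graph. Then $X_{\mathscr C}$ is acyclic: its set of path components $\pi_0(X_{\mathscr C})$ is discrete in the quotient topology, and the projection $X_{\mathscr C}\to\pi_0(X_{\mathscr C})$ is a homotopy equivalence. Moreover, for every effective diagram $D$, the subspace of $X_{\mathscr C}$ of all diagrams deformation equivalent to $D$ is contractible. The same two statements hold for the space of all train track diagrams in $\mathscr C$ between $b_0$ and $b_1$. -/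

import Mathlib

open CategoryTheory Topology ContinuousMap

universe v u

/-- A semimonoidal category: a category with a tensor product functor in two variables that is
associative up to a natural isomorphism satisfying the pentagon equation; no unit is required.
The strict ones are those whose associativity isomorphisms are identities. -/
class SemimonoidalCategory (C : Type u) [Category.{v} C] where
  tensor : C ⥤ C ⥤ C
  associator : bifunctorComp₁₂ tensor tensor ≅ bifunctorComp₂₃ tensor tensor
  pentagon : ∀ W X Y Z : C,
    (tensor.map (((associator.hom.app W).app X).app Y)).app Z ≫
        ((associator.hom.app W).app ((tensor.obj X).obj Y)).app Z ≫
        (tensor.obj W).map (((associator.hom.app X).app Y).app Z) =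
      ((associator.hom.app ((tensor.obj W).obj X)).app Y).app Z ≫
        ((associator.hom.app W).app X).app ((tensor.obj Y).obj Z)

/-- The tensor product `(⋯((X ⊗ X₁) ⊗ X₂) ⋯) ⊗ Xₙ` of a non-empty word `X, X₁, …, Xₙ`. -/
def SemimonoidalCategory.tensorWord {C : Type u} [Category.{v} C] [SemimonoidalCategory C]
    (X : C) (Xs : List C) : C :=
  Xs.foldl (fun A B => (SemimonoidalCategory.tensor.obj A).obj B) X

/-- A finite graph with boundary (parallel edges allowed): the boundary is a set of vertices of
degree one. Every edge `e` has a direction, from `bot e` to `top e`; for plane progressive graphs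
this will be the upward direction. -/
structure BGraph where
  V : Type
  E : Type
  finV : Finite V
  finE : Finite E
  bot : E → V
  top : E → V
  bdry : Set V
  bdry_degree : ∀ v ∈ bdry, Nat.card {e // bot e = v} + Nat.card {e // top e = v} = 1

namespace BGraph

instance (Γ : BGraph) : TopologicalSpace Γ.V := ⊥

instance (Γ : BGraph) : TopologicalSpace Γ.E := ⊥

/-- The gluing of the two ends of each edge to vertices. -/
inductive Glue (Γ : BGraph) : Γ.V ⊕ (Γ.E × unitInterval) → Γ.V ⊕ (Γ.E × unitInterval) → Prop
  | bot (e : Γ.E) : Glue Γ (Sum.inr (e, 0)) (Sum.inl (Γ.bot e))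
  | top (e : Γ.E) : Glue Γ (Sum.inr (e, 1)) (Sum.inl (Γ.top e))

/-- The underlying topological space of a finite graph, with the quotient topology. -/
def Space (Γ : BGraph) : Type := Quot Γ.Glue

instance (Γ : BGraph) : TopologicalSpace Γ.Space :=
  inferInstanceAs (TopologicalSpace (Quot Γ.Glue))

/-- The point of the graph given by a vertex. -/
def vertex (Γ : BGraph) (v : Γ.V) : Γ.Space := Quot.mk _ (Sum.inl v)

/-- The point with parameter `s` on the edge `e`. -/
def edge (Γ : BGraph) (e : Γ.E) (s : unitInterval) : Γ.Space := Quot.mk _ (Sum.inr (e, s))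

/-- The nodes are the vertices that are not in the boundary. -/
abbrev Node (Γ : BGraph) : Type := {v : Γ.V // v ∉ Γ.bdry}

/-- The node `N` has `p` input edges and `q` output edges. -/
def HasValence (Γ : BGraph) (N : Γ.Node) (p q : ℕ) : Prop :=
  Nat.card {e // Γ.top e = N.1} = p ∧ Nat.card {e // Γ.bot e = N.1} = q

/-- Non-empty, and every node has at least one input edge and at least one output edge. -/
def Effective (Γ : BGraph) : Prop :=
  Nonempty Γ.V ∧ ∀ N : Γ.Node, (∃ e, Γ.top e = N.1) ∧ (∃ e, Γ.bot e = N.1)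

/-- Non-empty, and every node has valence `(1,1)`, `(2,1)` or `(1,2)`. -/
def TrainTrack (Γ : BGraph) : Prop :=
  Nonempty Γ.V ∧ ∀ N : Γ.Node, Γ.HasValence N 1 1 ∨ Γ.HasValence N 2 1 ∨ Γ.HasValence N 1 2

/-- A map `f` from the graph to the plane is a progressive plane graph between the levels `b₀` and
`b₁`. Injectivity of the height on an edge amounts to strict monotonicity; the direction of the
edge is the one in which the height increases. -/
structure IsProgressive (Γ : BGraph) (b₀ b₁ : ℝ) (f : C(Γ.Space, ℝ × ℝ)) : Prop where
  embedding : IsEmbedding f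
  mem_strip : ∀ p, (f p).2 ∈ Set.Icc b₀ b₁
  boundary : ∀ p, ((f p).2 = b₀ ∨ (f p).2 = b₁) ↔ ∃ v ∈ Γ.bdry, p = Γ.vertex v
  progressive : ∀ e, StrictMono fun s => (f (Γ.edge e s)).2

/-- At some level, the edge `e` passes to the left of the edge `e'`. For two input edges of one
node of a progressive plane graph, or two output edges of one node, this is their natural
order. -/
def LeftOf (Γ : BGraph) (f : C(Γ.Space, ℝ × ℝ)) (e e' : Γ.E) : Prop :=
  ∃ s t, (f (Γ.edge e s)).2 = (f (Γ.edge e' t)).2 ∧ (f (Γ.edge e s)).1 < (f (Γ.edge e' t)).1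

/-- The list `l` consists of the edges in `S`, from left to right. -/
def IsEnumeration (Γ : BGraph) (f : C(Γ.Space, ℝ × ℝ)) (S : Set Γ.E) (l : List Γ.E) : Prop :=
  l.Nodup ∧ l.Pairwise (Γ.LeftOf f) ∧ ∀ e, e ∈ l ↔ e ∈ S

end BGraph

/-- A finite graph with boundary whose edges are labelled by objects and whose nodes are labelled
by arrows of `C`. -/
structure LabelledGraph (C : Type u) [Category.{v} C] where
  graph : BGraph
  obj : graph.E → C
  arrow : graph.Node → Arrow C

section

variable {C : Type u} [Category.{v} C] [SemimonoidalCategory C]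

open SemimonoidalCategory

/-- The object `X` is the tensor product, from left to right, of the labels of the edges
in `S`. -/
def LabelledGraph.IsTensor (G : LabelledGraph C) (f : C(G.graph.Space, ℝ × ℝ))
    (S : Set G.graph.E) (X : C) : Prop :=
  ∃ e l, G.graph.IsEnumeration f S (e :: l) ∧ X = tensorWord (G.obj e) (l.map G.obj)

/-- The map `f` makes the labelled graph `G` a progressive plane diagram between the levels `b₀`
and `b₁`: it is a progressive plane graph, and the source (target) of the label of each node is the
tensor product of the labels of its input (output) edges. -/
structure LabelledGraph.IsDiagram (G : LabelledGraph C) (b₀ b₁ : ℝ)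
    (f : C(G.graph.Space, ℝ × ℝ)) : Prop where
  isProgressive : G.graph.IsProgressive b₀ b₁ f
  source : ∀ N, G.IsTensor f {e | G.graph.top e = N.1} (G.arrow N).left
  target : ∀ N, G.IsTensor f {e | G.graph.bot e = N.1} (G.arrow N).right

variable (C) in
/-- The space of all progressive plane diagrams in `C` between the levels `b₀` and `b₁` whose graph
has the property `P`. It is the topological sum, over all labelled graphs, of sets of maps to the
plane with the compact-open topology. -/
abbrev DiagramSpace (b₀ b₁ : ℝ) (P : BGraph → Prop) :=
  Σ G : {G : LabelledGraph C // P G.graph}, {f : C(G.1.graph.Space, ℝ × ℝ) // G.1.IsDiagram b₀ b₁ f}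

/-- There is a deformation `h` from the diagram `D` to the diagram `D'`: both have the same
labelled graph, and every stage of `h` is a diagram with this labelled graph. -/
def DeformationEquivalent {b₀ b₁ : ℝ} {P : BGraph → Prop} (D D' : DiagramSpace C b₀ b₁ P) : Prop :=
  ∃ (G : {G : LabelledGraph C // P G.graph})
    (h : C(unitInterval × G.1.graph.Space, ℝ × ℝ))
    (stage : ∀ t, G.1.IsDiagram b₀ b₁ (h.curry t)),
    D = ⟨G, h.curry 0, stage 0⟩ ∧ D' = ⟨G, h.curry 1, stage 1⟩

end

/-- The set of path components is discrete in the quotient topology, and the projection to it is a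
homotopy equivalence. -/
def IsAcyclicSpace (X : Type*) [TopologicalSpace X] : Prop :=
  DiscreteTopology (ZerothHomotopy X) ∧
    ∃ e : X ≃ₕ ZerothHomotopy X, ∀ x, e x = ZerothHomotopy.mk x

/-! For a fixed effective graph, a plane graph is determined up to deformation by a discrete
invariant, a left-to-right relation on the edges, and the deformation to a normal form depends
continuously on the plane graph. So the identity is homotopic to a locally constant map `r`, whose
fibres are the path components; acyclicity and contractibility of the components follow formally.

The invariant: call two points comparable if one is reached from the other by ascending edges. This
depends on the graph only. Effectiveness puts every point on ascending paths through all levels, so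
incomparable points at different heights can still be compared horizontally. By the intermediate
value theorem, two ascending paths that change sides meet, which would make the points comparable;
hence the side does not depend on the chosen paths (`side_unique`). "Left of" is a strict partial
order under which any two incomparable points are related. It is a closed condition on the plane
graph, and so is its opposite, so it is locally constant (`isLocallyConstant_edgeOrder`). It also
determines the order of the edges at each node, so the label conditions survive.

The normal form: given a height function, draw each edge vertically at its rank in the order,
bending only near its ends towards a common position at each vertex. On every level the points then
stand in the prescribed order (`IsProgressive.position_lt`). Two drawings with the same heights and
the same order on each level are joined by a straight line in the horizontal direction. After this,
the heights are moved linearly to those of a plane graph chosen for each order, redrawing in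
standard form throughout. -/

namespace BGraph

/-! ### Points of a graph and reachability -/

variable {Γ : BGraph}

instance (Γ : BGraph) : DiscreteTopology Γ.V := ⟨rfl⟩

instance (Γ : BGraph) : DiscreteTopology Γ.E := ⟨rfl⟩

instance (Γ : BGraph) : Finite Γ.V := Γ.finV

instance (Γ : BGraph) : Finite Γ.E := Γ.finE

instance (Γ : BGraph) : CompactSpace Γ.Space :=
  inferInstanceAs (CompactSpace (Quot Γ.Glue))

theorem edge_zero (e : Γ.E) : Γ.edge e 0 = Γ.vertex (Γ.bot e) := Quot.sound (.bot e)

theorem edge_one (e : Γ.E) : Γ.edge e 1 = Γ.vertex (Γ.top e) := Quot.sound (.top e)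

theorem continuous_edge (e : Γ.E) : Continuous (Γ.edge e) :=
  continuous_quot_mk.comp (continuous_inr.comp (by fun_prop))

open Classical in
/-- The normal form of a point: a vertex, or an interior point of an edge. -/
noncomputable def norm (Γ : BGraph) : Γ.Space → Γ.V ⊕ (Γ.E × unitInterval) :=
  Quot.lift (fun a => match a with
    | .inl v => .inl v
    | .inr (e, s) => if s = 0 then .inl (Γ.bot e) else if s = 1 then .inl (Γ.top e) else .inr (e, s))
    (by rintro _ _ (e | e) <;> simp)

theorem norm_vertex (v : Γ.V) : Γ.norm (Γ.vertex v) = .inl v := rfl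

open Classical in
theorem norm_edge (e : Γ.E) (s : unitInterval) : Γ.norm (Γ.edge e s) =
    if s = 0 then .inl (Γ.bot e) else if s = 1 then .inl (Γ.top e) else .inr (e, s) := rfl

theorem vertex_injective : Function.Injective Γ.vertex := fun v w h => by
  simpa [norm_vertex] using congrArg Γ.norm h

theorem eq_of_edge_eq_edge {e e' : Γ.E} {s s' : unitInterval} (h : Γ.edge e s = Γ.edge e' s')
    (h0 : s ≠ 0) (h1 : s ≠ 1) : e' = e ∧ s' = s := by
  have := congrArg Γ.norm h
  rw [norm_edge, norm_edge, if_neg h0, if_neg h1] at this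
  split_ifs at this with h2 h3
  simp only [Sum.inr.injEq, Prod.mk.injEq] at this
  exact ⟨this.1.symm, this.2.symm⟩

theorem endpoint_of_vertex_eq_edge {v : Γ.V} {e : Γ.E} {s : unitInterval}
    (h : Γ.vertex v = Γ.edge e s) : (s = 0 ∧ Γ.bot e = v) ∨ (s = 1 ∧ Γ.top e = v) := by
  have := congrArg Γ.norm h
  rw [norm_vertex, norm_edge] at this
  split_ifs at this with h2 h3
  · exact .inl ⟨h2, (Sum.inl.inj this).symm⟩
  · exact .inr ⟨h3, (Sum.inl.inj this).symm⟩

/-- The point `q` is reached from `p` by going upwards along one edge. -/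
def Step (Γ : BGraph) (p q : Γ.Space) : Prop :=
  ∃ e s t, s ≤ t ∧ p = Γ.edge e s ∧ q = Γ.edge e t

/-- The point `q` is reached from `p` by going upwards along a sequence of edges. -/
def Reach (Γ : BGraph) : Γ.Space → Γ.Space → Prop := Relation.ReflTransGen Γ.Step

/-- One of the two points is reached from the other one by going upwards. -/
def Comparable (Γ : BGraph) (p q : Γ.Space) : Prop := Γ.Reach p q ∨ Γ.Reach q p

theorem Reach.refl (p : Γ.Space) : Γ.Reach p p := Relation.ReflTransGen.refl

theorem Reach.trans {p q r : Γ.Space} (h : Γ.Reach p q) (h' : Γ.Reach q r) : Γ.Reach p r :=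
  Relation.ReflTransGen.trans h h'

theorem Comparable.symm {p q : Γ.Space} (h : Γ.Comparable p q) : Γ.Comparable q p := Or.symm h

theorem Comparable.refl (p : Γ.Space) : Γ.Comparable p p := .inl (.refl p)

theorem reach_edge (e : Γ.E) {s t : unitInterval} (h : s ≤ t) :
    Γ.Reach (Γ.edge e s) (Γ.edge e t) := .single ⟨e, s, t, h, rfl, rfl⟩

theorem reach_top (e : Γ.E) (s : unitInterval) : Γ.Reach (Γ.edge e s) (Γ.vertex (Γ.top e)) :=
  edge_one e ▸ reach_edge e unitInterval.le_one'

theorem reach_bot (e : Γ.E) (s : unitInterval) : Γ.Reach (Γ.vertex (Γ.bot e)) (Γ.edge e s) :=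
  edge_zero e ▸ reach_edge e unitInterval.nonneg'

theorem comparable_edge (e : Γ.E) (s t : unitInterval) :
    Γ.Comparable (Γ.edge e s) (Γ.edge e t) :=
  (le_total s t).imp (reach_edge e) (reach_edge e)

/-- An interior point lies on no other edge, so the chain either starts on `e` or enters it through
the bottom vertex. The top end is excluded because other edges may lead there. -/
theorem Reach.of_to_edge {p q : Γ.Space} (h : Γ.Reach p q) :
    ∀ {e : Γ.E} {t : unitInterval}, t ≠ 1 → q = Γ.edge e t →
      (∃ s ≤ t, p = Γ.edge e s) ∨ Γ.Reach p (Γ.vertex (Γ.bot e)) := by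
  induction h with
  | refl => exact fun {e t} _ hq => .inl ⟨t, le_rfl, hq⟩
  | @tail q₀ q h hs ih =>
    intro e t ht hq
    by_cases h0 : t = 0
    · subst h0
      rw [edge_zero] at hq
      exact .inr (hq ▸ h.tail hs)
    obtain ⟨g, s', t', hst, rfl, rfl⟩ := hs
    obtain ⟨rfl, rfl⟩ := eq_of_edge_eq_edge hq.symm h0 ht
    have h1 : s' ≠ 1 := fun h => ht (le_antisymm unitInterval.le_one' (h ▸ hst))
    rcases ih h1 rfl with ⟨s, hs, hp⟩ | h
    · exact .inl ⟨s, hs.trans hst, hp⟩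
    · exact .inr h

theorem Reach.of_from_edge {p q : Γ.Space} (h : Γ.Reach p q) :
    ∀ {e : Γ.E} {t : unitInterval}, t ≠ 0 → p = Γ.edge e t →
      (∃ s, t ≤ s ∧ q = Γ.edge e s) ∨ Γ.Reach (Γ.vertex (Γ.top e)) q := by
  induction h using Relation.ReflTransGen.head_induction_on with
  | refl => exact fun {e t} _ hq => .inl ⟨t, le_rfl, hq⟩
  | @head q₀ q₁ hs h ih =>
    intro e t ht hq
    by_cases h0 : t = 1
    · subst h0
      rw [edge_one] at hq
      exact .inr (hq ▸ h.head hs)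
    obtain ⟨g, s', t', hst, rfl, rfl⟩ := hs
    obtain ⟨rfl, rfl⟩ := eq_of_edge_eq_edge hq.symm ht h0
    have h1 : t' ≠ 0 := fun h => ht (le_antisymm (h ▸ hst) unitInterval.nonneg')
    rcases ih h1 rfl with ⟨s, hs, hp⟩ | h
    · exact .inl ⟨s, hst.trans hs, hp⟩
    · exact .inr h

theorem Reach.of_from_vertex {p q : Γ.Space} (h : Γ.Reach p q) :
    ∀ {v : Γ.V}, p = Γ.vertex v → q = Γ.vertex v ∨
      ∃ e, Γ.bot e = v ∧ ((∃ t, q = Γ.edge e t) ∨ Γ.Reach (Γ.vertex (Γ.top e)) q) := by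
  induction h using Relation.ReflTransGen.head_induction_on with
  | refl => exact fun {v} hq => .inl hq
  | @head q₀ q₁ hs h ih =>
    intro v hv
    obtain ⟨g, s, t, hst, rfl, rfl⟩ := hs
    rcases endpoint_of_vertex_eq_edge hv.symm with ⟨rfl, rfl⟩ | ⟨rfl, rfl⟩
    · by_cases ht : t = 0
      · exact ih (by rw [ht, edge_zero])
      · rcases Reach.of_from_edge h ht rfl with ⟨s, -, hs⟩ | h
        · exact .inr ⟨g, rfl, .inl ⟨s, hs⟩⟩
        · exact .inr ⟨g, rfl, .inr h⟩
    · exact ih (by rw [le_antisymm unitInterval.le_one' hst, edge_one])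

/-- A point inside an edge is comparable to every point to which some point of the edge is
comparable. -/
theorem Comparable.of_inner {e : Γ.E} {t : unitInterval} {q : Γ.Space}
    (h : Γ.Comparable (Γ.edge e t) q) (h0 : t ≠ 0) (h1 : t ≠ 1) (s : unitInterval) :
    Γ.Comparable (Γ.edge e s) q := by
  rcases h with h | h
  · rcases h.of_from_edge h0 rfl with ⟨s', -, rfl⟩ | h
    · exact comparable_edge ..
    · exact .inl ((reach_top e s).trans h)
  · rcases h.of_to_edge h1 rfl with ⟨s', -, rfl⟩ | h
    · exact comparable_edge ..
    · exact .inr (h.trans (reach_bot e s))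

theorem isClosed_of_edges {S : Set Γ.Space} (h : ∀ e, IsClosed {t | Γ.edge e t ∈ S}) :
    IsClosed S := by
  refine (isQuotientMap_quot_mk (r := Γ.Glue)).isClosed_preimage.1
    (isClosed_sum_iff.2 ⟨isClosed_discrete _, ?_⟩)
  have : Sum.inr ⁻¹' (Quot.mk Γ.Glue ⁻¹' S) =
      ⋃ e, (Prod.mk e) '' {t | Γ.edge e t ∈ S} := by
    ext ⟨e, t⟩
    simp only [Set.mem_preimage, Set.mem_iUnion, Set.mem_image, Set.mem_ofPred_eq, Prod.mk.injEq]
    exact ⟨fun h => ⟨e, t, h, rfl, rfl⟩, by rintro ⟨e, t, h, rfl, rfl⟩; exact h⟩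
  rw [this]
  exact isClosed_iUnion_of_finite fun e =>
    (((h e).isCompact).image (by fun_prop)).isClosed

/-- On each edge the set is everything if the bottom end is reached, an upper interval starting at
`p` if `p` lies on the edge above its bottom end and below its top, and otherwise contains at most
the top end. -/
theorem isClosed_reach_from (p : Γ.Space) : IsClosed {q | Γ.Reach p q} := by
  refine isClosed_of_edges fun e => ?_
  change IsClosed {t | Γ.Reach p (Γ.edge e t)}
  by_cases h0 : Γ.Reach p (Γ.edge e 0)
  · convert isClosed_univ
    exact Set.eq_univ_of_forall fun t => h0.trans (reach_edge e unitInterval.nonneg')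
  have key : ∀ t ≠ 1, Γ.Reach p (Γ.edge e t) → ∃ s ≤ t, s ≠ 0 ∧ p = Γ.edge e s := by
    intro t ht h
    rcases h.of_to_edge ht rfl with ⟨s, hs, hp⟩ | h
    · exact ⟨s, hs, by rintro rfl; exact h0 (hp ▸ .refl _), hp⟩
    · exact absurd (edge_zero e ▸ h) h0
  by_cases h1 : ∃ t ≠ 1, Γ.Reach p (Γ.edge e t)
  · obtain ⟨t, ht, h⟩ := h1
    obtain ⟨s, hst, hs0, rfl⟩ := key t ht h
    have hs1 : s ≠ 1 := fun h => ht (le_antisymm unitInterval.le_one' (h ▸ hst))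
    convert isClosed_Ici (a := s)
    ext t'
    refine ⟨fun h' => ?_, fun h' => reach_edge e h'⟩
    by_cases ht' : t' = 1
    · exact ht' ▸ unitInterval.le_one'
    · obtain ⟨s', hs', -, heq⟩ := key t' ht' h'
      exact (eq_of_edge_eq_edge heq hs0 hs1).2 ▸ hs'
  · push Not at h1
    refine Set.Finite.isClosed ((Set.finite_singleton 1).subset fun t ht => ?_)
    by_contra h
    exact h1 t h ht

theorem isClosed_reach_to (p : Γ.Space) : IsClosed {q | Γ.Reach q p} := by
  refine isClosed_of_edges fun e => ?_
  change IsClosed {t | Γ.Reach (Γ.edge e t) p}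
  by_cases h0 : Γ.Reach (Γ.edge e 1) p
  · convert isClosed_univ
    exact Set.eq_univ_of_forall fun t => (reach_edge e unitInterval.le_one').trans h0
  have key : ∀ t ≠ 0, Γ.Reach (Γ.edge e t) p → ∃ s, t ≤ s ∧ s ≠ 1 ∧ p = Γ.edge e s := by
    intro t ht h
    rcases h.of_from_edge ht rfl with ⟨s, hs, hp⟩ | h
    · exact ⟨s, hs, by rintro rfl; exact h0 (hp ▸ .refl _), hp⟩
    · exact absurd (edge_one e ▸ h) h0
  by_cases h1 : ∃ t ≠ 0, Γ.Reach (Γ.edge e t) p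
  · obtain ⟨t, ht, h⟩ := h1
    obtain ⟨s, hst, hs0, rfl⟩ := key t ht h
    have hs1 : s ≠ 0 := fun h => ht (le_antisymm (h ▸ hst) unitInterval.nonneg')
    convert isClosed_Iic (a := s)
    ext t'
    refine ⟨fun h' => ?_, fun h' => reach_edge e h'⟩
    by_cases ht' : t' = 0
    · exact ht' ▸ unitInterval.nonneg'
    · obtain ⟨s', hs', -, heq⟩ := key t' ht' h'
      exact (eq_of_edge_eq_edge heq hs1 hs0).2 ▸ hs'
  · push Not at h1
    refine Set.Finite.isClosed ((Set.finite_singleton 0).subset fun t ht => ?_)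
    by_contra h
    exact h1 t h ht

theorem isClosed_comparable (p : Γ.Space) : IsClosed {q | Γ.Comparable p q} :=
  (isClosed_reach_from p).union (isClosed_reach_to p)

/-- Every vertex of an effective graph is an end of an edge. -/
theorem Effective.exists_incident (hΓ : Γ.Effective) (v : Γ.V) :
    ∃ e, Γ.bot e = v ∨ Γ.top e = v := by
  by_cases hv : v ∈ Γ.bdry
  · by_contra! h
    have h1 : IsEmpty {e // Γ.bot e = v} := ⟨fun e => (h e).1 e.2⟩
    have h2 : IsEmpty {e // Γ.top e = v} := ⟨fun e => (h e).2 e.2⟩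
    have := Γ.bdry_degree v hv
    simp at this
  · obtain ⟨e, he⟩ := (hΓ.2 ⟨v, hv⟩).1
    exact ⟨e, .inr he⟩

theorem Effective.exists_edge (hΓ : Γ.Effective) (p : Γ.Space) : ∃ e s, p = Γ.edge e s := by
  obtain ⟨v | ⟨e, s⟩, rfl⟩ := Quot.exists_rep p
  · obtain ⟨e, rfl | rfl⟩ := hΓ.exists_incident v
    · exact ⟨e, 0, (edge_zero e).symm⟩
    · exact ⟨e, 1, (edge_one e).symm⟩
  · exact ⟨e, s, rfl⟩

theorem Effective.nonempty_edge (hΓ : Γ.Effective) : Nonempty Γ.E := by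
  obtain ⟨v⟩ := hΓ.1
  exact ⟨(hΓ.exists_incident v).choose⟩

theorem TrainTrack.effective (hΓ : Γ.TrainTrack) : Γ.Effective := by
  refine ⟨hΓ.1, fun N => ?_⟩
  have key : 0 < Nat.card {e // Γ.top e = N.1} ∧ 0 < Nat.card {e // Γ.bot e = N.1} := by
    rcases hΓ.2 N with ⟨h, h'⟩ | ⟨h, h'⟩ | ⟨h, h'⟩ <;> omega
  obtain ⟨⟨e⟩, -⟩ := Nat.card_pos_iff.1 key.1
  obtain ⟨⟨e'⟩, -⟩ := Nat.card_pos_iff.1 key.2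
  exact ⟨⟨e.1, e.2⟩, ⟨e'.1, e'.2⟩⟩

end BGraph

/-! ### Heights and ascending curves -/

namespace BGraph

variable {Γ : BGraph}

section Height

variable {φ : Γ.Space → ℝ}

theorem Reach.eq_or_lt (hφ : ∀ e, StrictMono fun s => φ (Γ.edge e s)) {p q : Γ.Space}
    (h : Γ.Reach p q) : p = q ∨ φ p < φ q := by
  induction h with
  | refl => exact .inl rfl
  | @tail q₀ q _ hs ih =>
    have : q₀ = q ∨ φ q₀ < φ q := by
      obtain ⟨e, s, t, hst, rfl, rfl⟩ := hs
      rcases hst.eq_or_lt with rfl | hlt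
      · exact .inl rfl
      · exact .inr (hφ e hlt)
    rcases ih with rfl | ih
    · exact this
    · rcases this with rfl | h
      · exact .inr ih
      · exact .inr (ih.trans h)

theorem Reach.height_le (hφ : ∀ e, StrictMono fun s => φ (Γ.edge e s)) {p q : Γ.Space}
    (h : Γ.Reach p q) : φ p ≤ φ q :=
  (h.eq_or_lt hφ).elim (fun h => h ▸ le_rfl) le_of_lt

theorem Comparable.eq_of_height_eq (hφ : ∀ e, StrictMono fun s => φ (Γ.edge e s)) {p q : Γ.Space}
    (h : Γ.Comparable p q) (hpq : φ p = φ q) : p = q := by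
  rcases h with h | h
  · exact (h.eq_or_lt hφ).resolve_right hpq.not_lt
  · exact ((h.eq_or_lt hφ).resolve_right hpq.symm.not_lt).symm

theorem Comparable.reach_of_height_le (hφ : ∀ e, StrictMono fun s => φ (Γ.edge e s))
    {p q : Γ.Space} (h : Γ.Comparable p q) (hpq : φ p ≤ φ q) : Γ.Reach p q := by
  rcases h with h | h
  · exact h
  · rcases h.eq_or_lt hφ with rfl | h
    · exact .refl _
    · exact absurd h hpq.not_gt

theorem exists_edge_section (hc : Continuous φ) {e : Γ.E}
    (hφ : StrictMono fun s => φ (Γ.edge e s)) (s t : unitInterval) :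
    ∃ γ : ℝ → Γ.Space, ContinuousOn γ (Set.Icc (φ (Γ.edge e s)) (φ (Γ.edge e t))) ∧
      ∀ y ∈ Set.Icc (φ (Γ.edge e s)) (φ (Γ.edge e t)), φ (γ y) = y ∧
        Γ.Reach (Γ.edge e s) (γ y) ∧ Γ.Reach (γ y) (Γ.edge e t) := by
  classical
  have hcont : Continuous fun s => φ (Γ.edge e s) := hc.comp (continuous_edge e)
  have hemb := (hcont.isClosedEmbedding hφ.injective).isEmbedding
  have hmem : ∀ y ∈ Set.Icc (φ (Γ.edge e s)) (φ (Γ.edge e t)),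
      y ∈ Set.range fun s => φ (Γ.edge e s) := fun y hy =>
    mem_range_of_exists_le_of_exists_ge hcont ⟨s, hy.1⟩ ⟨t, hy.2⟩
  let γ : ℝ → Γ.Space := fun y =>
    if h : y ∈ Set.range fun s => φ (Γ.edge e s) then Γ.edge e (hemb.toHomeomorph.symm ⟨y, h⟩)
    else Γ.edge e s
  have hγ : ∀ u, γ (φ (Γ.edge e u)) = Γ.edge e u := fun u => by
    have : hemb.toHomeomorph.symm ⟨φ (Γ.edge e u), u, rfl⟩ = u := by
      rw [Homeomorph.symm_apply_eq]; rfl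
    simp only [γ]
    rw [dif_pos ⟨u, rfl⟩, this]
  refine ⟨γ, ?_, ?_⟩
  · refine ContinuousOn.mono ?_ hmem
    rw [continuousOn_iff_continuous_domRestrict]
    refine ((continuous_edge e).comp hemb.toHomeomorph.symm.continuous).congr fun y => ?_
    simp only [Set.domRestrict_apply, Function.comp, γ]
    rw [dif_pos y.2]
  · intro y hy
    obtain ⟨u, rfl⟩ := hmem y hy
    simp only at hy ⊢
    rw [hγ]
    exact ⟨rfl, reach_edge e (hφ.le_iff_le.1 hy.1), reach_edge e (hφ.le_iff_le.1 hy.2)⟩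

/-- A reachable point is reached along a curve parametrized by the height. -/
theorem Reach.exists_section (hc : Continuous φ)
    (hφ : ∀ e, StrictMono fun s => φ (Γ.edge e s)) {p q : Γ.Space} (h : Γ.Reach p q) :
    ∃ γ : ℝ → Γ.Space, ContinuousOn γ (Set.Icc (φ p) (φ q)) ∧
      ∀ y ∈ Set.Icc (φ p) (φ q), φ (γ y) = y ∧ Γ.Reach p (γ y) ∧ Γ.Reach (γ y) q := by
  classical
  induction h with
  | refl =>
    refine ⟨fun _ => p, continuousOn_const, fun y hy => ⟨le_antisymm hy.1 hy.2, .refl _, .refl _⟩⟩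
  | @tail q₀ q h hs ih =>
    have hs' : Γ.Reach q₀ q := .single hs
    obtain ⟨γ₁, hγ₁, h₁⟩ := ih
    obtain ⟨γ₂, hγ₂, h₂⟩ : ∃ γ : ℝ → Γ.Space, ContinuousOn γ (Set.Icc (φ q₀) (φ q)) ∧
        ∀ y ∈ Set.Icc (φ q₀) (φ q), φ (γ y) = y ∧ Γ.Reach q₀ (γ y) ∧ Γ.Reach (γ y) q := by
      obtain ⟨e, s, t, -, rfl, rfl⟩ := hs
      exact exists_edge_section hc (hφ e) s t
    have h0 : φ p ≤ φ q₀ := Reach.height_le hφ h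
    have h1 : φ q₀ ≤ φ q := hs'.height_le hφ
    -- Both values are comparable to `q₀` and have its height, so both equal `q₀` and the curves can
    -- be glued.
    have hq₀ : γ₁ (φ q₀) = γ₂ (φ q₀) := by
      have a := h₁ (φ q₀) ⟨h0, le_rfl⟩
      have b := h₂ (φ q₀) ⟨le_rfl, h1⟩
      rw [Comparable.eq_of_height_eq hφ (.inl a.2.2) a.1,
        ← Comparable.eq_of_height_eq hφ (.inl b.2.1) b.1.symm]
    refine ⟨fun y => if y ≤ φ q₀ then γ₁ y else γ₂ y, ?_, fun y hy => ?_⟩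
    · rw [← Set.Icc_union_Icc_eq_Icc h0 h1]
      refine ContinuousOn.union_of_isClosed ?_ ?_ isClosed_Icc isClosed_Icc
      · exact hγ₁.congr fun y hy => if_pos hy.2
      · refine hγ₂.congr fun y hy => ?_
        split_ifs with hle
        · rw [le_antisymm hle hy.1, hq₀]
        · rfl
    · dsimp only
      split_ifs with hle
      · obtain ⟨a, b, c⟩ := h₁ y ⟨hy.1, hle⟩
        exact ⟨a, b, c.trans hs'⟩
      · obtain ⟨a, b, c⟩ := h₂ y ⟨(not_le.1 hle).le, hy.2⟩
        exact ⟨a, Reach.trans h b, c⟩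

end Height

/-! ### The left-to-right order of points -/

section Order

variable {b₀ b₁ : ℝ} {f : C(Γ.Space, ℝ × ℝ)}

namespace IsProgressive

theorem continuous_height (_ : Γ.IsProgressive b₀ b₁ f) : Continuous fun p => (f p).2 :=
  continuous_snd.comp f.continuous

theorem reach_le (P : Γ.IsProgressive b₀ b₁ f) {p q : Γ.Space} (h : Γ.Reach p q) :
    (f p).2 ≤ (f q).2 :=
  h.height_le (φ := fun p => (f p).2) P.progressive

theorem eq_of_comparable (P : Γ.IsProgressive b₀ b₁ f) {p q : Γ.Space} (h : Γ.Comparable p q)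
    (hpq : (f p).2 = (f q).2) : p = q :=
  h.eq_of_height_eq (φ := fun p => (f p).2) P.progressive hpq

theorem reach_of_le (P : Γ.IsProgressive b₀ b₁ f) {p q : Γ.Space} (h : Γ.Comparable p q)
    (hpq : (f p).2 ≤ (f q).2) : Γ.Reach p q :=
  h.reach_of_height_le (φ := fun p => (f p).2) P.progressive hpq

theorem bot_bdry (P : Γ.IsProgressive b₀ b₁ f) {e : Γ.E} (h : Γ.bot e ∈ Γ.bdry) :
    (f (Γ.vertex (Γ.bot e))).2 = b₀ := by
  refine ((P.boundary _).2 ⟨_, h, rfl⟩).resolve_right fun h1 => ?_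
  have h2 := P.progressive e (zero_lt_one (α := unitInterval))
  simp only [edge_zero] at h2
  linarith [(P.mem_strip (Γ.edge e 1)).2]

theorem top_bdry (P : Γ.IsProgressive b₀ b₁ f) {e : Γ.E} (h : Γ.top e ∈ Γ.bdry) :
    (f (Γ.vertex (Γ.top e))).2 = b₁ := by
  refine ((P.boundary _).2 ⟨_, h, rfl⟩).resolve_left fun h1 => ?_
  have h2 := P.progressive e (zero_lt_one (α := unitInterval))
  simp only [edge_one] at h2
  linarith [(P.mem_strip (Γ.edge e 0)).1]

/-- By compactness there is a highest point above `q` with height at most `y`. If it were lower than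
`y`, one could climb further: a node has an output edge, and a boundary vertex at the top of an edge
has height `b₁`. -/
theorem exists_reach_from (P : Γ.IsProgressive b₀ b₁ f) (hΓ : Γ.Effective) (q : Γ.Space) {y : ℝ}
    (h1 : (f q).2 ≤ y) (h2 : y ≤ b₁) : ∃ q', Γ.Reach q q' ∧ (f q').2 = y := by
  have hS : IsCompact {q' | Γ.Reach q q' ∧ (f q').2 ≤ y} :=
    ((isClosed_reach_from q).inter (isClosed_le P.continuous_height continuous_const)).isCompact
  obtain ⟨r, ⟨hr, hry⟩, hmax⟩ := hS.exists_isMaxOn ⟨q, .refl q, h1⟩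
    P.continuous_height.continuousOn
  refine ⟨r, hr, hry.antisymm (not_lt.1 fun hlt => ?_)⟩
  obtain ⟨e, s, hs, rfl⟩ : ∃ e s, s ≠ 1 ∧ r = Γ.edge e s := by
    obtain ⟨e, s, rfl⟩ := hΓ.exists_edge r
    by_cases hs : s = 1
    · subst hs
      rw [edge_one] at hlt ⊢
      by_cases hv : Γ.top e ∈ Γ.bdry
      · linarith [P.top_bdry hv]
      · obtain ⟨g, hg⟩ := (hΓ.2 ⟨_, hv⟩).2
        exact ⟨g, 0, zero_ne_one, by rw [edge_zero, hg]⟩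
    · exact ⟨e, s, hs, rfl⟩
  have key : ∀ t, s < t → ¬ (f (Γ.edge e t)).2 ≤ y := fun t ht hy =>
    (P.progressive e ht).not_ge (hmax ⟨hr.trans (reach_edge e ht.le), hy⟩)
  have hs1 : s < 1 := lt_of_le_of_ne unitInterval.le_one' hs
  obtain ⟨t, ht⟩ := mem_range_of_exists_le_of_exists_ge
    (P.continuous_height.comp (continuous_edge e)) ⟨s, hry⟩ ⟨1, (not_le.1 (key 1 hs1)).le⟩
  simp only [Function.comp] at ht
  exact key t ((P.progressive e).lt_iff_lt.1 (by simpa [ht] using hlt)) ht.le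

theorem exists_reach_to (P : Γ.IsProgressive b₀ b₁ f) (hΓ : Γ.Effective) (q : Γ.Space) {y : ℝ}
    (h1 : y ≤ (f q).2) (h2 : b₀ ≤ y) : ∃ q', Γ.Reach q' q ∧ (f q').2 = y := by
  have hS : IsCompact {q' | Γ.Reach q' q ∧ y ≤ (f q').2} :=
    ((isClosed_reach_to q).inter (isClosed_le continuous_const P.continuous_height)).isCompact
  obtain ⟨r, ⟨hr, hry⟩, hmax⟩ := hS.exists_isMinOn ⟨q, .refl q, h1⟩
    P.continuous_height.continuousOn
  refine ⟨r, hr, hry.antisymm' (not_lt.1 fun hlt => ?_)⟩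
  obtain ⟨e, s, hs, rfl⟩ : ∃ e s, s ≠ 0 ∧ r = Γ.edge e s := by
    obtain ⟨e, s, rfl⟩ := hΓ.exists_edge r
    by_cases hs : s = 0
    · subst hs
      rw [edge_zero] at hlt ⊢
      by_cases hv : Γ.bot e ∈ Γ.bdry
      · linarith [P.bot_bdry hv]
      · obtain ⟨g, hg⟩ := (hΓ.2 ⟨_, hv⟩).1
        exact ⟨g, 1, one_ne_zero, by rw [edge_one, hg]⟩
    · exact ⟨e, s, hs, rfl⟩
  have key : ∀ t, t < s → ¬ y ≤ (f (Γ.edge e t)).2 := fun t ht hy =>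
    (P.progressive e ht).not_ge (hmax ⟨(reach_edge e ht.le).trans hr, hy⟩)
  have hs1 : 0 < s := unitInterval.pos_iff_ne_zero.2 hs
  obtain ⟨t, ht⟩ := mem_range_of_exists_le_of_exists_ge
    (P.continuous_height.comp (continuous_edge e)) ⟨0, (not_le.1 (key 0 hs1)).le⟩ ⟨s, hry⟩
  simp only [Function.comp] at ht
  exact key t ((P.progressive e).lt_iff_lt.1 (by simpa [ht] using hlt)) ht.ge

/-- Two comparable points lie on a common ascending path through all levels. -/
theorem exists_comparable (P : Γ.IsProgressive b₀ b₁ f) (hΓ : Γ.Effective) {p q : Γ.Space}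
    (h : Γ.Comparable p q) {y : ℝ} (hy : y ∈ Set.Icc b₀ b₁) :
    ∃ r, Γ.Comparable p r ∧ Γ.Comparable q r ∧ (f r).2 = y := by
  wlog hpq : Γ.Reach p q generalizing p q
  · obtain ⟨r, h1, h2, h3⟩ := this h.symm (h.resolve_left hpq)
    exact ⟨r, h2, h1, h3⟩
  rcases le_total y (f p).2 with h1 | h1
  · obtain ⟨r, hr, hry⟩ := P.exists_reach_to hΓ p h1 hy.1
    exact ⟨r, .inr hr, .inr (hr.trans hpq), hry⟩
  rcases le_total y (f q).2 with h2 | h2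
  · obtain ⟨γ, -, hγ⟩ := hpq.exists_section P.continuous_height P.progressive
    obtain ⟨a, b, c⟩ := hγ y ⟨h1, h2⟩
    exact ⟨γ y, .inl b, .inr c, a⟩
  · obtain ⟨r, hr, hry⟩ := P.exists_reach_from hΓ q h2 hy.2
    exact ⟨r, .inl (hpq.trans hr), .inl hr, hry⟩

/-- Two ascending curves that change sides meet. -/
theorem exists_crossing (P : Γ.IsProgressive b₀ b₁ f) {p p' q q' : Γ.Space}
    (hp : Γ.Reach p p') (hq : Γ.Reach q q') (h : (f p).2 = (f q).2) (h' : (f p').2 = (f q').2)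
    (hlt : (f p).1 ≤ (f q).1) (hlt' : (f q').1 ≤ (f p').1) :
    ∃ r, Γ.Reach p r ∧ Γ.Reach r p' ∧ Γ.Reach q r ∧ Γ.Reach r q' := by
  obtain ⟨γ, hγ, hγr⟩ := hp.exists_section P.continuous_height P.progressive
  obtain ⟨δ, hδ, hδr⟩ := hq.exists_section P.continuous_height P.progressive
  have hle := P.reach_le hp
  rw [← h, ← h'] at hδ hδr
  have ends : ∀ y ∈ Set.Icc (f p).2 (f p').2, (y = (f p).2 → γ y = p ∧ δ y = q) ∧
      (y = (f p').2 → γ y = p' ∧ δ y = q') := by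
    intro y hy
    obtain ⟨a, b, c⟩ := hγr y hy
    obtain ⟨a', b', c'⟩ := hδr y hy
    refine ⟨fun hy => ⟨?_, ?_⟩, fun hy => ⟨?_, ?_⟩⟩
    · exact (P.eq_of_comparable (.inl b) (by linarith)).symm
    · exact (P.eq_of_comparable (.inl b') (by linarith)).symm
    · exact P.eq_of_comparable (.inl c) (by linarith)
    · exact P.eq_of_comparable (.inl c') (by linarith)
  have hcont : ContinuousOn (fun y => (f (δ y)).1 - (f (γ y)).1) (Set.Icc (f p).2 (f p').2) :=
    ((continuous_fst.comp f.continuous).comp_continuousOn hδ).sub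
      ((continuous_fst.comp f.continuous).comp_continuousOn hγ)
  obtain ⟨y, hy, h0⟩ := intermediate_value_Icc' hle hcont (show (0 : ℝ) ∈ _ by
    obtain ⟨e1, e2⟩ := (ends _ ⟨le_rfl, hle⟩).1 rfl
    obtain ⟨e3, e4⟩ := (ends _ ⟨hle, le_rfl⟩).2 rfl
    rw [e1, e2, e3, e4]
    exact ⟨by linarith, by linarith⟩)
  obtain ⟨a, b, c⟩ := hγr y hy
  obtain ⟨a', b', c'⟩ := hδr y hy
  have : δ y = γ y := P.embedding.injective (Prod.ext (by linarith) (a'.trans a.symm))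
  rw [this] at b' c'
  exact ⟨_, b, c, b', c'⟩

/-- Between the two levels run ascending curves from `p` to `p'` and from `q'` to `q`. If they
changed sides they would meet, and `q` would be reached from `p` through the meeting point. -/
theorem side_unique_of_le (P : Γ.IsProgressive b₀ b₁ f) {p q p' q' : Γ.Space}
    (h : ¬ Γ.Comparable p q) (hq : Γ.Comparable q q') (hq' : (f q').2 = (f p).2)
    (hp : Γ.Comparable p p') (hp' : (f p').2 = (f q).2) (hle : (f p).2 ≤ (f q).2) :
    (f p).1 < (f q').1 ↔ (f p').1 < (f q).1 := by
  have hpr : Γ.Reach p p' := P.reach_of_le hp (by rwa [hp'])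
  have hqr : Γ.Reach q' q := P.reach_of_le hq.symm (by rwa [hq'])
  constructor
  · intro hlt
    by_contra! hge
    obtain ⟨r, h1, -, -, h2⟩ := P.exists_crossing hpr hqr hq'.symm hp' hlt.le hge
    exact h (.inl (h1.trans h2))
  · intro hlt
    by_contra! hge
    obtain ⟨r, -, h2, h1, -⟩ := P.exists_crossing hqr hpr hq' hp'.symm hge hlt.le
    exact h (.inl (h1.trans h2))

/-- Since `p'` and `q'` vary independently, neither choice affects the side. Horizontal ties would
identify two points and make `p` and `q` comparable, so the case of the lower `q` follows by
negating both sides. -/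
theorem side_unique (P : Γ.IsProgressive b₀ b₁ f) {p q p' q' : Γ.Space}
    (h : ¬ Γ.Comparable p q) (hq : Γ.Comparable q q') (hq' : (f q').2 = (f p).2)
    (hp : Γ.Comparable p p') (hp' : (f p').2 = (f q).2) :
    (f p).1 < (f q').1 ↔ (f p').1 < (f q).1 := by
  rcases le_total (f p).2 (f q).2 with hle | hle
  · exact P.side_unique_of_le h hq hq' hp hp' hle
  · have hn : ¬ Γ.Comparable q p := fun h' => h h'.symm
    have key := P.side_unique_of_le hn hp hp' hq hq' hle
    have h1 : (f p).1 ≠ (f q').1 := fun he => h (by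
      rw [P.embedding.injective (Prod.ext he hq'.symm)]; exact hq.symm)
    have h2 : (f p').1 ≠ (f q).1 := fun he => h (by
      rw [← P.embedding.injective (Prod.ext he hp')]; exact hp)
    rw [← not_iff_not, not_lt, not_lt, h1.symm.le_iff_lt, h2.symm.le_iff_lt]
    exact key.symm

end IsProgressive

/-- The point `p` is to the left of the point `q`: they are incomparable, and at the level of `p`
some ascending path through `q` is to the right of `p`. -/
def LeftOfPoint (Γ : BGraph) (f : C(Γ.Space, ℝ × ℝ)) (p q : Γ.Space) : Prop :=
  ¬ Γ.Comparable p q ∧ ∃ q', Γ.Comparable q q' ∧ (f q').2 = (f p).2 ∧ (f p).1 < (f q').1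

namespace IsProgressive

theorem exists_level (P : Γ.IsProgressive b₀ b₁ f) (hΓ : Γ.Effective) (p q : Γ.Space) :
    ∃ p', Γ.Comparable p p' ∧ (f p').2 = (f q).2 := by
  obtain ⟨r, h, -, h'⟩ := P.exists_comparable hΓ (.refl p) (P.mem_strip q)
  exact ⟨r, h, h'⟩

theorem not_comparable (P : Γ.IsProgressive b₀ b₁ f) {p q : Γ.Space} (h : (f p).2 = (f q).2)
    (hpq : p ≠ q) : ¬ Γ.Comparable p q := fun hc => hpq (P.eq_of_comparable hc h)

theorem leftOfPoint_of_lt (P : Γ.IsProgressive b₀ b₁ f) {p q : Γ.Space}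
    (h : (f p).2 = (f q).2) (hlt : (f p).1 < (f q).1) : Γ.LeftOfPoint f p q :=
  ⟨P.not_comparable h (fun h => by simp [h] at hlt), q, .refl q, h.symm, hlt⟩

theorem lt_of_leftOfPoint_left (P : Γ.IsProgressive b₀ b₁ f) (hΓ : Γ.Effective) {p q q' : Γ.Space}
    (h : Γ.LeftOfPoint f p q) (hq : Γ.Comparable q q') (hq' : (f q').2 = (f p).2) :
    (f p).1 < (f q').1 := by
  obtain ⟨h, q₁, h1, h2, h3⟩ := h
  obtain ⟨p', hp, hp'⟩ := P.exists_level hΓ p q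
  exact (P.side_unique h hq hq' hp hp').2 ((P.side_unique h h1 h2 hp hp').1 h3)

theorem lt_of_leftOfPoint_right (P : Γ.IsProgressive b₀ b₁ f) {p q p' : Γ.Space}
    (h : Γ.LeftOfPoint f p q) (hp : Γ.Comparable p p') (hp' : (f p').2 = (f q).2) :
    (f p').1 < (f q).1 := by
  obtain ⟨h, q₁, h1, h2, h3⟩ := h
  exact (P.side_unique h h1 h2 hp hp').1 h3

theorem leftOfPoint_total (P : Γ.IsProgressive b₀ b₁ f) (hΓ : Γ.Effective) {p q : Γ.Space}
    (h : ¬ Γ.Comparable p q) : Γ.LeftOfPoint f p q ∨ Γ.LeftOfPoint f q p := by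
  obtain ⟨p', hp, hp'⟩ := P.exists_level hΓ p q
  obtain ⟨q', hq, hq'⟩ := P.exists_level hΓ q p
  by_cases hlt : (f p).1 < (f q').1
  · exact .inl ⟨h, q', hq, hq', hlt⟩
  · rw [P.side_unique h hq hq' hp hp', not_lt] at hlt
    refine .inr ⟨fun h' => h h'.symm, p', hp, hp', lt_of_le_of_ne hlt fun he => h ?_⟩
    rw [P.embedding.injective (Prod.ext he hp'.symm)]; exact hp

theorem leftOfPoint_asymm (P : Γ.IsProgressive b₀ b₁ f) (hΓ : Γ.Effective) {p q : Γ.Space}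
    (h : Γ.LeftOfPoint f p q) : ¬ Γ.LeftOfPoint f q p := fun h' => by
  obtain ⟨p', hp, hp'⟩ := P.exists_level hΓ p q
  exact lt_asymm (P.lt_of_leftOfPoint_right h hp hp') (P.lt_of_leftOfPoint_left hΓ h' hp hp')

/-- An ascending path through `p` and `r` would cross the level of `q` both to the left and to the
right of `q`. -/
theorem not_comparable_of_leftOfPoint (P : Γ.IsProgressive b₀ b₁ f) (hΓ : Γ.Effective)
    {p q r : Γ.Space} (h : Γ.LeftOfPoint f p q) (h' : Γ.LeftOfPoint f q r) :
    ¬ Γ.Comparable p r := fun hc => by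
  obtain ⟨s, h1, h2, h3⟩ := P.exists_comparable hΓ hc (P.mem_strip q)
  exact lt_asymm (P.lt_of_leftOfPoint_right h h1 h3) (P.lt_of_leftOfPoint_left hΓ h' h2 h3)

theorem leftOfPoint_of_comparable_left (P : Γ.IsProgressive b₀ b₁ f) (hΓ : Γ.Effective)
    {p p' q : Γ.Space} (h : Γ.LeftOfPoint f p q) (hp : Γ.Comparable p p')
    (hn : ¬ Γ.Comparable p' q) : Γ.LeftOfPoint f p' q :=
  (P.leftOfPoint_total hΓ hn).resolve_right fun h' =>
    P.not_comparable_of_leftOfPoint hΓ h h' hp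

theorem leftOfPoint_of_comparable_right (P : Γ.IsProgressive b₀ b₁ f) (hΓ : Γ.Effective)
    {p q q' : Γ.Space} (h : Γ.LeftOfPoint f p q) (hq : Γ.Comparable q q')
    (hn : ¬ Γ.Comparable p q') : Γ.LeftOfPoint f p q' :=
  (P.leftOfPoint_total hΓ hn).resolve_right fun h' =>
    P.not_comparable_of_leftOfPoint hΓ h' h hq.symm

theorem leftOfPoint_trans (P : Γ.IsProgressive b₀ b₁ f) (hΓ : Γ.Effective) {p q r : Γ.Space}
    (h : Γ.LeftOfPoint f p q) (h' : Γ.LeftOfPoint f q r) : Γ.LeftOfPoint f p r := by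
  obtain ⟨p', hp, hp'⟩ := P.exists_level hΓ p q
  obtain ⟨r', hr, hr'⟩ := P.exists_level hΓ r q
  have h1 := P.lt_of_leftOfPoint_right h hp hp'
  have h2 := P.lt_of_leftOfPoint_left hΓ h' hr hr'
  -- At the level of `q` transitivity is that of the real line. Returning from `p'`, `r'` to `p`,
  -- `r` moves one point at a time, so the mixed pair `p`, `r'` must be incomparable too.
  have h3 : ¬ Γ.Comparable p r' := fun hc => h2.not_gt (P.lt_of_leftOfPoint_right h hc hr')
  have h4 := P.leftOfPoint_of_lt (hp'.trans hr'.symm) (h1.trans h2)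
  exact P.leftOfPoint_of_comparable_right hΓ (P.leftOfPoint_of_comparable_left hΓ h4 hp.symm h3)
    hr.symm (P.not_comparable_of_leftOfPoint hΓ h h')

end IsProgressive

end Order

end BGraph

/-! ### The order of edges and its local constancy -/

namespace BGraph

variable {Γ : BGraph} {b₀ b₁ : ℝ} {f g : C(Γ.Space, ℝ × ℝ)}

/-- The midpoint of an edge. -/
noncomputable def mid (Γ : BGraph) (e : Γ.E) : Γ.Space :=
  Γ.edge e ⟨1 / 2, by norm_num, by norm_num⟩

/-- Interior points have the fewest comparable points on their edge, so the midpoint inherits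
incomparability; this is why midpoints represent edges in the order. -/
theorem not_comparable_mid {e : Γ.E} {s : unitInterval} {q : Γ.Space}
    (h : ¬ Γ.Comparable (Γ.edge e s) q) : ¬ Γ.Comparable (Γ.mid e) q := fun h' =>
  h (h'.of_inner (by simp [Subtype.ext_iff]) (by norm_num [Subtype.ext_iff]) s)

/-- The edge `e` is to the left of the edge `e'`. Unlike `LeftOf`, this applies also to edges that
share no level. -/
def EdgeOrder (Γ : BGraph) (f : C(Γ.Space, ℝ × ℝ)) (e e' : Γ.E) : Prop :=
  Γ.LeftOfPoint f (Γ.mid e) (Γ.mid e')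

namespace IsProgressive

theorem edgeOrder_of_leftOfPoint (P : Γ.IsProgressive b₀ b₁ f) (hΓ : Γ.Effective) {e e' : Γ.E}
    {s s' : unitInterval} (h : Γ.LeftOfPoint f (Γ.edge e s) (Γ.edge e' s')) :
    Γ.EdgeOrder f e e' := by
  have h1 := not_comparable_mid h.1
  have h2 := not_comparable_mid fun h' => h1 (Comparable.symm h')
  exact P.leftOfPoint_of_comparable_right hΓ
    (P.leftOfPoint_of_comparable_left hΓ h (comparable_edge ..) h1) (comparable_edge ..)
    fun h' => h2 h'.symm

theorem edgeOrder_of_leftOf (P : Γ.IsProgressive b₀ b₁ f) (hΓ : Γ.Effective) {e e' : Γ.E}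
    (h : Γ.LeftOf f e e') : Γ.EdgeOrder f e e' := by
  obtain ⟨s, t, h1, h2⟩ := h
  exact P.edgeOrder_of_leftOfPoint hΓ (P.leftOfPoint_of_lt h1 h2)

/-- Edges with a common end share a level: the edge whose midpoint is farther in height from that
end crosses the level of the other midpoint. -/
theorem leftOf_of_edgeOrder (P : Γ.IsProgressive b₀ b₁ f) (hΓ : Γ.Effective) {e e' : Γ.E}
    (h : Γ.EdgeOrder f e e') (hv : Γ.top e = Γ.top e' ∨ Γ.bot e = Γ.bot e') :
    Γ.LeftOf f e e' := by
  have hc : ∀ e, Continuous fun s => (f (Γ.edge e s)).2 := fun e =>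
    P.continuous_height.comp (continuous_edge e)
  have key : (∃ s, (f (Γ.edge e s)).2 = (f (Γ.mid e')).2) ∨
      ∃ t, (f (Γ.edge e' t)).2 = (f (Γ.mid e)).2 := by
    rcases hv with hv | hv <;> rcases le_total (f (Γ.mid e)).2 (f (Γ.mid e')).2 with hle | hle
    · refine .inl (mem_range_of_exists_le_of_exists_ge (hc e) ⟨_, hle⟩ ⟨1, ?_⟩)
      rw [edge_one, hv]
      exact P.reach_le (reach_top e' _)
    · refine .inr (mem_range_of_exists_le_of_exists_ge (hc e') ⟨_, hle⟩ ⟨1, ?_⟩)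
      rw [edge_one, ← hv]
      exact P.reach_le (reach_top e _)
    · refine .inr (mem_range_of_exists_le_of_exists_ge (hc e') ⟨0, ?_⟩ ⟨_, hle⟩)
      rw [edge_zero, ← hv]
      exact P.reach_le (reach_bot e _)
    · refine .inl (mem_range_of_exists_le_of_exists_ge (hc e) ⟨0, ?_⟩ ⟨_, hle⟩)
      rw [edge_zero, hv]
      exact P.reach_le (reach_bot e' _)
  rcases key with ⟨s, hs⟩ | ⟨t, ht⟩
  · exact ⟨s, _, hs, P.lt_of_leftOfPoint_right h (comparable_edge ..) hs⟩
  · exact ⟨_, t, ht.symm, P.lt_of_leftOfPoint_left hΓ h (comparable_edge ..) ht⟩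

end IsProgressive

/-- The space of progressive plane graphs between the levels `b₀` and `b₁` with a given graph. -/
abbrev ProgressiveSpace (Γ : BGraph) (b₀ b₁ : ℝ) : Type :=
  {f : C(Γ.Space, ℝ × ℝ) // Γ.IsProgressive b₀ b₁ f}

/-- The set is the projection of a closed set along the compact factor `Γ.Space`. The strict
inequality may be weakened, as equality would identify `p` with a point comparable to `q`. -/
theorem isClosed_leftOfPoint [T2Space Γ.Space] {p q : Γ.Space} (h : ¬ Γ.Comparable p q) :
    IsClosed {F : Γ.ProgressiveSpace b₀ b₁ | Γ.LeftOfPoint F.1 p q} := by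
  have hS : IsClosed {z : Γ.ProgressiveSpace b₀ b₁ × Γ.Space | Γ.Comparable q z.2 ∧
      (z.1.1 z.2).2 = (z.1.1 p).2 ∧ (z.1.1 p).1 ≤ (z.1.1 z.2).1} := by
    have h1 : Continuous fun z : Γ.ProgressiveSpace b₀ b₁ × Γ.Space => z.1.1 z.2 := by fun_prop
    have h2 : Continuous fun z : Γ.ProgressiveSpace b₀ b₁ × Γ.Space => z.1.1 p := by fun_prop
    exact ((isClosed_comparable q).preimage continuous_snd).inter
      ((isClosed_eq h1.snd h2.snd).inter (isClosed_le h2.fst h1.fst))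
  convert isClosedMap_fst_of_compactSpace _ hS using 1
  ext F
  constructor
  · rintro ⟨-, q', h1, h2, h3⟩
    exact ⟨(F, q'), ⟨h1, h2, h3.le⟩, rfl⟩
  · rintro ⟨⟨F, q'⟩, ⟨h1, h2, h3⟩, rfl⟩
    refine ⟨h, q', h1, h2, lt_of_le_of_ne h3 fun he => h ?_⟩
    rw [F.2.embedding.injective (Prod.ext he h2.symm)]
    exact h1.symm

/-- For each of the finitely many pairs of edges with incomparable midpoints, exactly one of two
closed conditions holds, so both are open. Comparability itself does not depend on the map. -/
theorem isLocallyConstant_edgeOrder [T2Space Γ.Space] (hΓ : Γ.Effective) :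
    IsLocallyConstant fun F : Γ.ProgressiveSpace b₀ b₁ => Γ.EdgeOrder F.1 := by
  rw [IsLocallyConstant.iff_eventually_eq]
  intro F
  have key : ∀ e e', ∀ᶠ G : Γ.ProgressiveSpace b₀ b₁ in 𝓝 F,
      Γ.EdgeOrder G.1 e e' = Γ.EdgeOrder F.1 e e' := by
    intro e e'
    by_cases hc : Γ.Comparable (Γ.mid e) (Γ.mid e')
    · exact .of_forall fun G => propext ⟨fun h => absurd hc h.1, fun h => absurd hc h.1⟩
    have hop : ∀ {p q : Γ.Space}, ¬ Γ.Comparable p q → Γ.LeftOfPoint F.1 p q →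
        ∀ᶠ G : Γ.ProgressiveSpace b₀ b₁ in 𝓝 F, Γ.LeftOfPoint G.1 p q := by
      intro p q hn hF
      have hcl := isClosed_leftOfPoint (b₀ := b₀) (b₁ := b₁) fun h => hn (Comparable.symm h)
      filter_upwards [hcl.isOpen_compl.mem_nhds (F.2.leftOfPoint_asymm hΓ hF)] with G hG
      exact (G.2.leftOfPoint_total hΓ hn).resolve_right hG
    rcases F.2.leftOfPoint_total hΓ hc with hF | hF
    · filter_upwards [hop hc hF] with G hG
      exact propext ⟨fun _ => hF, fun _ => hG⟩
    · filter_upwards [hop (fun h => hc h.symm) hF] with G hG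
      exact propext ⟨fun h => absurd hG (G.2.leftOfPoint_asymm hΓ h),
        fun h => absurd hF (F.2.leftOfPoint_asymm hΓ h)⟩
  filter_upwards [Filter.eventually_all.2 fun e => Filter.eventually_all.2 (key e)] with G hG
  exact funext fun e => funext fun e' => hG e e'

end BGraph

section

variable {C : Type u} [Category.{v} C] [SemimonoidalCategory C]

theorem LabelledGraph.IsTensor.of_leftOf {G : LabelledGraph C} {f g : C(G.graph.Space, ℝ × ℝ)}
    {S : Set G.graph.E} {X : C} (h : G.IsTensor f S X)
    (hfg : ∀ e ∈ S, ∀ e' ∈ S, G.graph.LeftOf f e e' → G.graph.LeftOf g e e') :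
    G.IsTensor g S X := by
  obtain ⟨e, l, ⟨h1, h2, h3⟩, h4⟩ := h
  exact ⟨e, l, ⟨h1, h2.imp_of_mem fun ha hb => hfg _ ((h3 _).1 ha) _ ((h3 _).1 hb), h3⟩, h4⟩

/-- The labels only see the order among the inputs or outputs of one node. These edges share an end,
so the edge order determines it. -/
theorem LabelledGraph.IsDiagram.of_edgeOrder {G : LabelledGraph C} {b₀ b₁ : ℝ}
    {f g : C(G.graph.Space, ℝ × ℝ)} (D : G.IsDiagram b₀ b₁ f) (hG : G.graph.Effective)
    (P : G.graph.IsProgressive b₀ b₁ g) (h : G.graph.EdgeOrder f = G.graph.EdgeOrder g) :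
    G.IsDiagram b₀ b₁ g := by
  have key : ∀ {e e' : G.graph.E}, G.graph.LeftOf f e e' → G.graph.EdgeOrder g e e' :=
    fun h' => h ▸ D.isProgressive.edgeOrder_of_leftOf hG h'
  refine ⟨P, fun N => (D.source N).of_leftOf ?_, fun N => (D.target N).of_leftOf ?_⟩
  · exact fun e he e' he' h' => P.leftOf_of_edgeOrder hG (key h') (.inl (Eq.trans he he'.symm))
  · exact fun e he e' he' h' => P.leftOf_of_edgeOrder hG (key h') (.inr (Eq.trans he he'.symm))

end

/-! ### The standard drawing with given heights -/

namespace BGraph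

variable {Γ : BGraph}

section Section

variable {φ : Γ.Space → ℝ} {x : Γ.E → ℝ}

noncomputable instance (Γ : BGraph) : Fintype Γ.E := Fintype.ofFinite _

/-- A positive number that is at most a third of the height of each edge. -/
noncomputable def gap (Γ : BGraph) (φ : Γ.Space → ℝ) : ℝ :=
  (∑ e, (φ (Γ.edge e 1) - φ (Γ.edge e 0))⁻¹)⁻¹ / 3

theorem gap_pos (hΓ : Γ.Effective) (hφ : ∀ e, StrictMono fun s => φ (Γ.edge e s)) :
    0 < Γ.gap φ := by
  have := hΓ.nonempty_edge
  exact div_pos (inv_pos.2 (Finset.sum_pos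
    (fun e _ => inv_pos.2 (sub_pos.2 (hφ e zero_lt_one))) Finset.univ_nonempty)) (by norm_num)

theorem gap_le (hφ : ∀ e, StrictMono fun s => φ (Γ.edge e s)) (e : Γ.E) :
    3 * Γ.gap φ ≤ φ (Γ.edge e 1) - φ (Γ.edge e 0) := by
  have h : ∀ e, 0 < (φ (Γ.edge e 1) - φ (Γ.edge e 0))⁻¹ := fun e =>
    inv_pos.2 (sub_pos.2 (hφ e zero_lt_one))
  have h1 := Finset.single_le_sum (f := fun e => (φ (Γ.edge e 1) - φ (Γ.edge e 0))⁻¹)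
    (fun e _ => (h e).le) (Finset.mem_univ e)
  have h2 := inv_anti₀ (h e) h1
  rw [inv_inv] at h2
  unfold gap
  linarith

theorem continuous_gap {Y : Type*} [TopologicalSpace Y] {Φ : Y → Γ.Space → ℝ}
    (hΓ : Γ.Effective) (hΦ : ∀ p, Continuous fun y => Φ y p)
    (hm : ∀ y e, StrictMono fun s => Φ y (Γ.edge e s)) : Continuous fun y => Γ.gap (Φ y) := by
  have := hΓ.nonempty_edge
  refine Continuous.div_const (Continuous.inv₀ (continuous_finsetSum _ fun e _ =>
    ((hΦ _).sub (hΦ _)).inv₀ fun y => (sub_pos.2 (hm y e zero_lt_one)).ne') fun y => ?_) 3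
  exact (Finset.sum_pos
    (fun e _ => inv_pos.2 (sub_pos.2 (hm y e zero_lt_one))) Finset.univ_nonempty).ne'

/-- An edge with the end `v`. -/
noncomputable def Effective.incident (hΓ : Γ.Effective) (v : Γ.V) : Γ.E :=
  (hΓ.exists_incident v).choose

theorem Effective.exists_incident_eq (hΓ : Γ.Effective) (v : Γ.V) :
    ∃ s, Γ.vertex v = Γ.edge (hΓ.incident v) s := by
  rcases (hΓ.exists_incident v).choose_spec with h | h
  · exact ⟨0, by rw [edge_zero]; exact congrArg _ h.symm⟩
  · exact ⟨1, by rw [edge_one]; exact congrArg _ h.symm⟩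

/-- The horizontal coordinate at a point of an edge `e` in the standard drawing with a given height
function `φ`: it is `x e` except near the ends of `e`, where all edges converge to a common
position. -/
noncomputable def edgePosition (hΓ : Γ.Effective) (x : Γ.E → ℝ) (φ : Γ.Space → ℝ) (e : Γ.E)
    (s : unitInterval) : ℝ :=
  x e + (x (hΓ.incident (Γ.bot e)) - x e) *
      max 0 (1 - (φ (Γ.edge e s) - φ (Γ.edge e 0)) / Γ.gap φ) +
    (x (hΓ.incident (Γ.top e)) - x e) *
      max 0 (1 - (φ (Γ.edge e 1) - φ (Γ.edge e s)) / Γ.gap φ)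

/-- The horizontal coordinate in the standard drawing with a given height function. -/
noncomputable def position (hΓ : Γ.Effective) (x : Γ.E → ℝ) (φ : Γ.Space → ℝ) (p : Γ.Space) : ℝ :=
  edgePosition hΓ x φ (hΓ.exists_edge p).choose (hΓ.exists_edge p).choose_spec.choose

theorem edgePosition_zero (hΓ : Γ.Effective) (hφ : ∀ e, StrictMono fun s => φ (Γ.edge e s))
    (e : Γ.E) : edgePosition hΓ x φ e 0 = x (hΓ.incident (Γ.bot e)) := by
  have h1 := gap_pos hΓ hφ
  have h2 : 1 - (φ (Γ.edge e 1) - φ (Γ.edge e 0)) / Γ.gap φ ≤ 0 := by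
    rw [sub_nonpos, one_le_div h1]
    linarith [gap_le hφ e]
  simp [edgePosition, max_eq_left h2]

theorem edgePosition_one (hΓ : Γ.Effective) (hφ : ∀ e, StrictMono fun s => φ (Γ.edge e s))
    (e : Γ.E) : edgePosition hΓ x φ e 1 = x (hΓ.incident (Γ.top e)) := by
  have h1 := gap_pos hΓ hφ
  have h2 : 1 - (φ (Γ.edge e 1) - φ (Γ.edge e 0)) / Γ.gap φ ≤ 0 := by
    rw [sub_nonpos, one_le_div h1]
    linarith [gap_le hφ e]
  simp [edgePosition, max_eq_left h2]

/-- Only vertices lie on several edges, and there all edge formulas give the position of the chosen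
incident edge. -/
theorem position_edge (hΓ : Γ.Effective) (hφ : ∀ e, StrictMono fun s => φ (Γ.edge e s)) (e : Γ.E)
    (s : unitInterval) : position hΓ x φ (Γ.edge e s) = edgePosition hΓ x φ e s := by
  have h := (hΓ.exists_edge (Γ.edge e s)).choose_spec.choose_spec
  unfold position
  generalize (hΓ.exists_edge (Γ.edge e s)).choose_spec.choose = s' at h ⊢
  generalize (hΓ.exists_edge (Γ.edge e s)).choose = e' at h ⊢
  have key : ∀ v, Γ.vertex v = Γ.edge e' s' →
      edgePosition hΓ x φ e' s' = x (hΓ.incident v) := by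
    intro v hv
    rcases endpoint_of_vertex_eq_edge hv with ⟨rfl, rfl⟩ | ⟨rfl, rfl⟩
    · exact edgePosition_zero hΓ hφ e'
    · exact edgePosition_one hΓ hφ e'
  by_cases h0 : s = 0
  · subst h0
    rw [edgePosition_zero hΓ hφ, key (Γ.bot e) (by rw [← h, edge_zero])]
  by_cases h1 : s = 1
  · subst h1
    rw [edgePosition_one hΓ hφ, key (Γ.top e) (by rw [← h, edge_one])]
  obtain ⟨rfl, rfl⟩ := eq_of_edge_eq_edge h h0 h1
  rfl

/-- The position on an edge interpolates between the position of the edge and that of its nearest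
end. -/
theorem exists_position_eq (hΓ : Γ.Effective) (hφ : ∀ e, StrictMono fun s => φ (Γ.edge e s))
    (x : Γ.E → ℝ) (e : Γ.E) (s : unitInterval) : ∃ v, (v = Γ.bot e ∨ v = Γ.top e) ∧
      (∀ w, (w = Γ.bot e ∨ w = Γ.top e) → w ≠ v →
        Γ.gap φ ≤ |φ (Γ.edge e s) - φ (Γ.vertex w)|) ∧
      position hΓ x φ (Γ.edge e s) = x e + (x (hΓ.incident v) - x e) *
        max 0 (1 - |φ (Γ.edge e s) - φ (Γ.vertex v)| / Γ.gap φ) := by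
  have h0 := gap_pos hΓ hφ
  have h1 := gap_le hφ e
  have h2 : φ (Γ.edge e 0) ≤ φ (Γ.edge e s) := (hφ e).monotone unitInterval.nonneg'
  have h3 : φ (Γ.edge e s) ≤ φ (Γ.edge e 1) := (hφ e).monotone unitInterval.le_one'
  have far : ∀ u, Γ.gap φ ≤ u → max 0 (1 - u / Γ.gap φ) = 0 := fun u hu =>
    max_eq_left (sub_nonpos.2 ((one_le_div h0).2 hu))
  -- An edge is at least three gaps high, so at most one of its two bending terms is nonzero.
  by_cases h : φ (Γ.edge e s) - φ (Γ.edge e 0) < Γ.gap φ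
  · refine ⟨Γ.bot e, .inl rfl, ?_, ?_⟩
    · rintro w (rfl | rfl) hw
      · exact absurd rfl hw
      · rw [← edge_one, abs_sub_comm]
        exact le_trans (by linarith) (le_abs_self _)
    · rw [position_edge hΓ hφ, edgePosition, far (φ (Γ.edge e 1) - φ (Γ.edge e s)) (by linarith),
        ← edge_zero, abs_of_nonneg (sub_nonneg.2 h2), mul_zero, add_zero]
  · push Not at h
    refine ⟨Γ.top e, .inr rfl, ?_, ?_⟩
    · rintro w (rfl | rfl) hw
      · rw [← edge_zero]
        exact h.trans (le_abs_self _)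
      · exact absurd rfl hw
    · rw [position_edge hΓ hφ, edgePosition, far (φ (Γ.edge e s) - φ (Γ.edge e 0)) h,
        ← edge_one, abs_sub_comm, abs_of_nonneg (sub_nonneg.2 h3), mul_zero, add_zero]

theorem Reach.vertex_eq_or_gap_le (hφ : ∀ e, StrictMono fun s => φ (Γ.edge e s)) {v : Γ.V}
    {w : Γ.V} (h : Γ.Reach (Γ.vertex v) (Γ.vertex w)) :
    v = w ∨ 3 * Γ.gap φ ≤ φ (Γ.vertex w) - φ (Γ.vertex v) := by
  rcases h.of_from_vertex rfl with h | ⟨e, rfl, ⟨t, ht⟩ | h⟩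
  · exact .inl (vertex_injective h.symm)
  · rcases endpoint_of_vertex_eq_edge ht with ⟨-, rfl⟩ | ⟨-, rfl⟩
    · exact .inl rfl
    · refine .inr ?_
      rw [← edge_zero, ← edge_one]
      exact gap_le hφ e
  · refine .inr ?_
    have h1 := gap_le hφ e
    have h2 := h.height_le hφ
    rw [edge_zero, edge_one] at h1
    linarith

theorem Comparable.vertex_eq_or_gap_le (hφ : ∀ e, StrictMono fun s => φ (Γ.edge e s)) {v : Γ.V}
    {w : Γ.V} (h : Γ.Comparable (Γ.vertex v) (Γ.vertex w)) :
    v = w ∨ 3 * Γ.gap φ ≤ |φ (Γ.vertex v) - φ (Γ.vertex w)| := by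
  rcases h with h | h
  · rw [abs_sub_comm]
    exact (h.vertex_eq_or_gap_le hφ).imp_right fun h => h.trans (le_abs_self _)
  · exact (h.vertex_eq_or_gap_le hφ).imp Eq.symm fun h => h.trans (le_abs_self _)

/-- An ascending path between the point and a vertex that is not an end of `e` contains a whole
edge. -/
theorem Comparable.endpoint_or_gap_le (hφ : ∀ e, StrictMono fun s => φ (Γ.edge e s)) {v : Γ.V}
    {e : Γ.E} {s : unitInterval} (h : Γ.Comparable (Γ.vertex v) (Γ.edge e s)) :
    (v = Γ.bot e ∨ v = Γ.top e) ∨ 3 * Γ.gap φ ≤ |φ (Γ.edge e s) - φ (Γ.vertex v)| := by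
  rcases h with h | h
  · by_cases hs : s = 1
    · subst hs
      rw [edge_one] at h ⊢
      rcases h.vertex_eq_or_gap_le hφ with h | h
      · exact .inl (.inr h)
      · exact .inr (h.trans (le_abs_self _))
    · rcases h.of_to_edge hs rfl with ⟨t, -, ht⟩ | h
      · rcases endpoint_of_vertex_eq_edge ht with ⟨-, h⟩ | ⟨-, h⟩
        · exact .inl (.inl h.symm)
        · exact .inl (.inr h.symm)
      · rcases h.vertex_eq_or_gap_le hφ with h | h
        · exact .inl (.inl h)
        · refine .inr (le_trans ?_ (le_abs_self _))
          linarith [(reach_bot e s).height_le hφ]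
  · rw [abs_sub_comm]
    by_cases hs : s = 0
    · subst hs
      rw [edge_zero] at h ⊢
      rcases h.vertex_eq_or_gap_le hφ with h | h
      · exact .inl (.inl h.symm)
      · exact .inr (h.trans (le_abs_self _))
    · rcases h.of_from_edge hs rfl with ⟨t, -, ht⟩ | h
      · rcases endpoint_of_vertex_eq_edge ht with ⟨-, h⟩ | ⟨-, h⟩
        · exact .inl (.inl h.symm)
        · exact .inl (.inr h.symm)
      · rcases h.vertex_eq_or_gap_le hφ with h | h
        · exact .inl (.inr h.symm)
        · refine .inr (le_trans ?_ (le_abs_self _))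
          linarith [(reach_top e s).height_le hφ]

/-- Both sides are convex combinations, and every value with positive weight on the left must lie
below every such value on the right. The ends `X`, `X'` matter only when their weights are positive.
-/
theorem interpolation_lt {a a' x x' X X' : ℝ} (ha : 0 ≤ a) (ha1 : a ≤ 1) (ha' : 0 ≤ a')
    (ha1' : a' ≤ 1) (h : x < x') (h1 : 0 < a → X < x') (h2 : 0 < a' → x < X')
    (h3 : 0 < a → 0 < a' → X < X') : x + (X - x) * a < x' + (X' - x') * a' := by
  rcases ha.eq_or_lt with rfl | ha <;> rcases ha'.eq_or_lt with rfl | ha'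
  · simpa using h
  · nlinarith [h2 ha', mul_nonneg (sub_nonneg.2 ha1') (sub_pos.2 h).le, mul_pos ha' (sub_pos.2 (h2 ha'))]
  · nlinarith [h1 ha, mul_nonneg (sub_nonneg.2 ha1) (sub_pos.2 h).le, mul_pos ha (sub_pos.2 (h1 ha))]
  · have h1 := h1 ha
    have h2 := h2 ha'
    have h3 := h3 ha ha'
    have hl : x + (X - x) * a ≤ max x X := by
      nlinarith [le_max_left x X, le_max_right x X]
    have hr : min x' X' ≤ x' + (X' - x') * a' := by
      nlinarith [min_le_left x' X', min_le_right x' X']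
    exact hl.trans_lt (lt_of_lt_of_le (max_lt (lt_min h h2) (lt_min h1 h3)) hr)

/-- In the standard drawing with any height function, the points of each level are in the order
prescribed by a given progressive plane graph. -/
theorem IsProgressive.position_lt {b₀ b₁ : ℝ} {f : C(Γ.Space, ℝ × ℝ)}
    (P : Γ.IsProgressive b₀ b₁ f) (hΓ : Γ.Effective)
    (hφ : ∀ e, StrictMono fun s => φ (Γ.edge e s))
    (hx : ∀ e e', Γ.EdgeOrder f e e' → x e < x e') {p q : Γ.Space} (h : Γ.LeftOfPoint f p q)
    (hpq : φ p = φ q) : position hΓ x φ p < position hΓ x φ q := by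
  obtain ⟨e, s, rfl⟩ := hΓ.exists_edge p
  obtain ⟨e', s', rfl⟩ := hΓ.exists_edge q
  obtain ⟨v, hv, hvf, hvp⟩ := exists_position_eq hΓ hφ x e s
  obtain ⟨v', hv', hvf', hvp'⟩ := exists_position_eq hΓ hφ x e' s'
  have h0 := gap_pos hΓ hφ
  have hxe := hx _ _ (P.edgeOrder_of_leftOfPoint hΓ h)
  have hcv : ∀ {e s v}, v = Γ.bot e ∨ v = Γ.top e → Γ.Comparable (Γ.edge e s) (Γ.vertex v) := by
    rintro e s v (rfl | rfl)
    · exact .inr (reach_bot e s)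
    · exact .inl (reach_top e s)
  have near : ∀ u, 0 < max 0 (1 - u / Γ.gap φ) → u < Γ.gap φ := fun u hu => by
    rcases lt_max_iff.1 hu with hu | hu
    · exact absurd hu (lt_irrefl 0)
    · rwa [sub_pos, div_lt_one h0] at hu
  have le_one : ∀ u, 0 ≤ u → max 0 (1 - u / Γ.gap φ) ≤ 1 := fun u hu =>
    max_le zero_le_one (by linarith [div_nonneg hu h0.le])
  have inc : ∀ {p q e s e' s'}, p = Γ.edge e s → q = Γ.edge e' s' → Γ.LeftOfPoint f p q →
      x e < x e' := by
    rintro p q e s e' s' rfl rfl h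
    exact hx _ _ (P.edgeOrder_of_leftOfPoint hΓ h)
  obtain ⟨t, ht⟩ := hΓ.exists_incident_eq v
  obtain ⟨t', ht'⟩ := hΓ.exists_incident_eq v'
  rw [hvp, hvp']
  -- With the same nearest vertex and the same height, both edges bend by the same factor `a`, and
  -- the difference of positions is `(1 - a) * (x e' - x e)`. The factor is less than `1`, since
  -- otherwise both points would be that vertex.
  by_cases hvv : v = v'
  · subst hvv
    rw [hpq]
    have ha : max 0 (1 - |φ (Γ.edge e' s') - φ (Γ.vertex v)| / Γ.gap φ) < 1 := by
      refine max_lt zero_lt_one (sub_lt_self 1 (div_pos (abs_pos.2 fun h' => ?_) h0))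
      have e1 := (hcv (s := s) hv).eq_of_height_eq hφ (by linarith)
      have e2 := (hcv (s := s') hv').eq_of_height_eq hφ (by linarith)
      exact h.1 (by rw [e1, e2]; exact .refl _)
    nlinarith
  -- A vertex within a gap of the common level is incomparable to the other point: it would
  -- otherwise be the farther end of `e'`, or at least three gaps away.
  have hvq : |φ (Γ.edge e s) - φ (Γ.vertex v)| < Γ.gap φ →
      Γ.LeftOfPoint f (Γ.vertex v) (Γ.edge e' s') := fun hlt => by
    refine P.leftOfPoint_of_comparable_left hΓ h (hcv hv) fun hc => ?_
    rw [hpq] at hlt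
    rcases hc.endpoint_or_gap_le hφ with hw | hw
    · exact (hvf' v hw hvv).not_gt hlt
    · linarith
  have hvq' : |φ (Γ.edge e' s') - φ (Γ.vertex v')| < Γ.gap φ →
      Γ.LeftOfPoint f (Γ.edge e s) (Γ.vertex v') := fun hlt => by
    refine P.leftOfPoint_of_comparable_right hΓ h (hcv hv') fun hc => ?_
    rw [← hpq] at hlt
    rcases hc.symm.endpoint_or_gap_le hφ with hw | hw
    · exact (hvf v' hw (Ne.symm hvv)).not_gt hlt
    · linarith
  refine interpolation_lt (le_max_left ..) (le_one _ (abs_nonneg _)) (le_max_left ..)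
    (le_one _ (abs_nonneg _)) hxe (fun ha => inc ht rfl (hvq (near _ ha)))
    (fun ha => inc rfl ht' (hvq' (near _ ha))) fun ha ha' => inc ht ht' ?_
  -- Both vertices are within a gap of the common level, hence too close to each other to be
  -- distinct and comparable.
  have n1 := near _ ha
  have n2 := near _ ha'
  refine P.leftOfPoint_of_comparable_right hΓ (hvq n1) (hcv hv') fun hc => ?_
  rcases hc.vertex_eq_or_gap_le hφ with hw | hw
  · exact hvv hw
  · have := abs_sub_le (φ (Γ.vertex v)) (φ (Γ.edge e s)) (φ (Γ.vertex v'))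
    rw [abs_sub_comm, hpq] at n1
    rw [hpq] at this
    linarith

/-- The number of edges to the left of a given edge. -/
noncomputable def rank (R : Γ.E → Γ.E → Prop) (e : Γ.E) : ℝ := ({e' | R e' e} : Set Γ.E).ncard

theorem IsProgressive.rank_lt {b₀ b₁ : ℝ} {f : C(Γ.Space, ℝ × ℝ)}
    (P : Γ.IsProgressive b₀ b₁ f) (hΓ : Γ.Effective) {e e' : Γ.E} (h : Γ.EdgeOrder f e e') :
    rank (Γ.EdgeOrder f) e < rank (Γ.EdgeOrder f) e' := by
  refine Nat.cast_lt.2 (Set.ncard_lt_ncard ⟨fun g hg => ?_, fun hs => ?_⟩ (Set.toFinite _))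
  · exact P.leftOfPoint_trans hΓ hg h
  · exact P.leftOfPoint_asymm hΓ (hs h) (hs h)

theorem continuous_position [T2Space Γ.Space] {Y : Type*} [TopologicalSpace Y]
    {Φ : Y → Γ.Space → ℝ} {x : Y → Γ.E → ℝ} (hΓ : Γ.Effective)
    (hΦ : Continuous fun z : Y × Γ.Space => Φ z.1 z.2)
    (hm : ∀ y e, StrictMono fun s => Φ y (Γ.edge e s)) (hx : ∀ e, Continuous fun y => x y e) :
    Continuous fun z : Y × Γ.Space => position hΓ (x z.1) (Φ z.1) z.2 := by
  let π : Γ.E × unitInterval → Γ.Space := fun z => Γ.edge z.1 z.2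
  have hπ : Continuous π := continuous_prod_of_discrete_left.2 fun e => continuous_edge e
  -- Products of quotient maps need not be quotient maps; this one is, because `π` is proper. So
  -- continuity can be tested on edges.
  have hq : IsQuotientMap (Prod.map (id : Y → Y) π) :=
    (isProperMap_id.prodMap hπ.isProperMap).isClosedMap.isQuotientMap (continuous_id.prodMap hπ)
      (Function.surjective_id.prodMap fun p => by
        obtain ⟨e, s, rfl⟩ := hΓ.exists_edge p
        exact ⟨(e, s), rfl⟩)
  rw [hq.continuous_iff]
  have hg : Continuous fun y => Γ.gap (Φ y) :=
    continuous_gap hΓ (fun p => hΦ.comp (by fun_prop : Continuous fun y : Y => (y, p))) hm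
  have key : Continuous fun z : Γ.E × (Y × unitInterval) =>
      position hΓ (x z.2.1) (Φ z.2.1) (Γ.edge z.1 z.2.2) := by
    refine continuous_prod_of_discrete_left.2 fun e => ?_
    have hΦe : Continuous fun z : Y × unitInterval => Φ z.1 (Γ.edge e z.2) :=
      hΦ.comp (continuous_fst.prodMk ((continuous_edge e).comp continuous_snd))
    have hΦs : ∀ s, Continuous fun z : Y × unitInterval => Φ z.1 (Γ.edge e s) := fun s =>
      hΦ.comp (continuous_fst.prodMk continuous_const)
    have hxe : ∀ e, Continuous fun z : Y × unitInterval => x z.1 e := fun e =>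
      (hx e).comp continuous_fst
    have hge : Continuous fun z : Y × unitInterval => Γ.gap (Φ z.1) := hg.comp continuous_fst
    simp only [fun y s => position_edge (x := x y) hΓ (hm y) e s, edgePosition]
    have hne : ∀ z : Y × unitInterval, Γ.gap (Φ z.1) ≠ 0 := fun z => (gap_pos hΓ (hm z.1)).ne'
    exact ((hxe _).add (((hxe _).sub (hxe _)).mul (continuous_const.max
      (continuous_const.sub ((hΦe.sub (hΦs 0)).div hge hne))))).add
      (((hxe _).sub (hxe _)).mul (continuous_const.max
      (continuous_const.sub (((hΦs 1).sub hΦe).div hge hne))))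
  exact key.comp (by fun_prop : Continuous fun z : Y × Γ.E × unitInterval =>
    (z.2.1, (z.1, z.2.2)))

end Section

end BGraph

/-! ### Deformation to a normal form -/

namespace BGraph

variable {Γ : BGraph} {b₀ b₁ : ℝ} {f g : C(Γ.Space, ℝ × ℝ)}

namespace IsProgressive

/-- Whether a boundary vertex lies at `b₀` or `b₁` is dictated by the direction of its edge, so
interpolating heights keeps it on its level. -/
theorem height_eq_of_bdry (P : Γ.IsProgressive b₀ b₁ f) (Q : Γ.IsProgressive b₀ b₁ g)
    (hΓ : Γ.Effective) {v : Γ.V} (hv : v ∈ Γ.bdry) :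
    (f (Γ.vertex v)).2 = (g (Γ.vertex v)).2 := by
  obtain ⟨e, rfl | rfl⟩ := hΓ.exists_incident v
  · rw [P.bot_bdry hv, Q.bot_bdry hv]
  · rw [P.top_bdry hv, Q.top_bdry hv]

theorem mem_Ioo (P : Γ.IsProgressive b₀ b₁ f) {p : Γ.Space}
    (hp : ¬ ∃ v ∈ Γ.bdry, p = Γ.vertex v) : (f p).2 ∈ Set.Ioo b₀ b₁ := by
  have h := P.mem_strip p
  have h' := mt (P.boundary p).1 hp
  push Not at h'
  exact ⟨lt_of_le_of_ne h.1 h'.1.symm, lt_of_le_of_ne h.2 h'.2⟩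

theorem strictMono_segment (P : Γ.IsProgressive b₀ b₁ f) (Q : Γ.IsProgressive b₀ b₁ g)
    (t : unitInterval) (e : Γ.E) :
    StrictMono fun s => (1 - t : ℝ) * (f (Γ.edge e s)).2 + t * (g (Γ.edge e s)).2 := by
  intro s s' h
  have h1 := P.progressive e h
  have h2 := Q.progressive e h
  have h3 := t.2.1
  have h4 := t.2.2
  dsimp only at h1 h2 ⊢
  rcases h3.eq_or_lt with h3 | h3
  · rw [← h3]
    linarith
  · nlinarith

/-- A map whose heights interpolate between those of two progressive plane graphs and which respects
the order of points on each level is a progressive plane graph. -/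
theorem of_segment [T2Space Γ.Space] {k : C(Γ.Space, ℝ × ℝ)} (P : Γ.IsProgressive b₀ b₁ f)
    (Q : Γ.IsProgressive b₀ b₁ g) (hΓ : Γ.Effective) (t : unitInterval)
    (hk : ∀ p, (k p).2 = (1 - t : ℝ) * (f p).2 + t * (g p).2)
    (hlt : ∀ p q, Γ.LeftOfPoint f p q → (k p).2 = (k q).2 → (k p).1 < (k q).1) :
    Γ.IsProgressive b₀ b₁ k := by
  have h3 := t.2.1
  have h4 := t.2.2
  have hm : ∀ e, StrictMono fun s => (k (Γ.edge e s)).2 := fun e => by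
    simpa only [hk] using P.strictMono_segment Q t e
  have hmem : ∀ p, (k p).2 ∈ Set.Icc b₀ b₁ := fun p => by
    rw [hk]
    exact convex_Icc b₀ b₁ (P.mem_strip p) (Q.mem_strip p) (sub_nonneg.2 h4) h3 (by ring)
  refine ⟨(k.continuous.isClosedEmbedding fun p q hpq => ?_).isEmbedding, hmem, fun p => ?_, hm⟩
  · by_contra hne
    have hh := congrArg Prod.snd hpq
    have hn : ¬ Γ.Comparable p q := fun hc =>
      hne (hc.eq_of_height_eq (φ := fun p => (k p).2) hm hh)
    rcases P.leftOfPoint_total hΓ hn with h | h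
    · exact (hlt _ _ h hh).ne (congrArg Prod.fst hpq)
    · exact (hlt _ _ h hh.symm).ne (congrArg Prod.fst hpq).symm
  · constructor
    · intro h
      by_contra hp
      have := convex_Ioo b₀ b₁ (P.mem_Ioo hp) (Q.mem_Ioo hp) (sub_nonneg.2 h4) h3 (by ring)
      rw [smul_eq_mul, smul_eq_mul, ← hk] at this
      exact h.elim this.1.ne' this.2.ne
    · rintro ⟨v, hv, rfl⟩
      have := (P.boundary _).2 ⟨v, hv, rfl⟩
      rw [hk, ← P.height_eq_of_bdry Q hΓ hv]
      convert this using 2 <;> ring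

end IsProgressive

theorem ProgressiveSpace.continuous_eval [T2Space Γ.Space] :
    Continuous fun z : Γ.ProgressiveSpace b₀ b₁ × Γ.Space => z.1.1 z.2 := by
  fun_prop

/-- The progressive plane graphs with a given effective graph can be deformed simultaneously, in
such a way that the result depends only on the order of the edges. -/
theorem ProgressiveSpace.exists_homotopic_isLocallyConstant (hΓ : Γ.Effective) (b₀ b₁ : ℝ) :
    ∃ r : C(Γ.ProgressiveSpace b₀ b₁, Γ.ProgressiveSpace b₀ b₁),
      (ContinuousMap.id _).Homotopic r ∧ IsLocallyConstant r := by
  rcases isEmpty_or_nonempty (Γ.ProgressiveSpace b₀ b₁) with hX | hX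
  · exact ⟨.id _, .refl _, fun s => by convert isOpen_empty; exact Subsingleton.elim _ _⟩
  have : T2Space Γ.Space := hX.some.2.embedding.t2Space
  let X := Γ.ProgressiveSpace b₀ b₁
  have hev : Continuous fun z : X × Γ.Space => z.1.1 z.2 := ProgressiveSpace.continuous_eval
  let ord : X → Γ.E → Γ.E → Prop := fun F => Γ.EdgeOrder F.1
  have hord : IsLocallyConstant ord := isLocallyConstant_edgeOrder hΓ
  -- One plane graph is chosen for each order. Only its heights are used, as the common target for
  -- all plane graphs with that order.
  let base : X → X := fun F => Function.invFun ord (ord F)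
  have hbase : IsLocallyConstant base := hord.comp (Function.invFun ord)
  let x : X → Γ.E → ℝ := fun F => rank (ord F)
  have hx : ∀ e, Continuous fun F => x F e := fun e =>
    (hord.comp fun R => rank R e).continuous
  let h : unitInterval × X → Γ.Space → ℝ := fun z p =>
    (1 - z.1 : ℝ) * (z.2.1 p).2 + z.1 * ((base z.2).1 p).2
  have hh : Continuous fun z : (unitInterval × X) × Γ.Space => h z.1 z.2 := by
    have hb := hbase.continuous
    have h1 : Continuous fun z : (unitInterval × X) × Γ.Space => z.1.2.1 z.2 :=
      hev.comp (continuous_fst.snd.prodMk continuous_snd)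
    have h2 : Continuous fun z : (unitInterval × X) × Γ.Space => (base z.1.2).1 z.2 :=
      hev.comp ((hb.comp continuous_fst.snd).prodMk continuous_snd)
    have h3 : Continuous fun z : (unitInterval × X) × Γ.Space => (z.1.1 : ℝ) := by fun_prop
    exact ((continuous_const.sub h3).mul h1.snd).add (h3.mul h2.snd)
  have hm : ∀ z e, StrictMono fun s => h z (Γ.edge e s) := fun z e =>
    z.2.2.strictMono_segment (base z.2).2 z.1 e
  have hpos : Continuous fun z : (unitInterval × X) × Γ.Space =>
      position hΓ (x z.1.2) (h z.1) z.2 :=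
    continuous_position hΓ hh hm fun e => (hx e).comp continuous_snd
  have hlt : ∀ z p q, Γ.LeftOfPoint z.2.1 p q → h z p = h z q →
      position hΓ (x z.2) (h z) p < position hΓ (x z.2) (h z) q := fun z p q hl he =>
    z.2.2.position_lt hΓ (hm z) (fun _ _ => z.2.2.rank_lt hΓ) hl he
  let K₂ : C(unitInterval × X, C(Γ.Space, ℝ × ℝ)) :=
    ContinuousMap.curry ⟨fun z => (position hΓ (x z.1.2) (h z.1) z.2, h z.1 z.2), hpos.prodMk hh⟩
  have hK₂ : ∀ z, Γ.IsProgressive b₀ b₁ (K₂ z) := fun z =>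
    z.2.2.of_segment (base z.2).2 hΓ z.1 (fun p => rfl) (hlt z)
  have h0 : ∀ F p, h (0, F) p = (F.1 p).2 := fun F p => by simp [h]
  let K₁ : C(unitInterval × X, C(Γ.Space, ℝ × ℝ)) :=
    ContinuousMap.curry ⟨fun z => ((1 - z.1.1 : ℝ) * (z.1.2.1 z.2).1 +
      z.1.1 * position hΓ (x z.1.2) (h (0, z.1.2)) z.2, (z.1.2.1 z.2).2), by
        have h1 : Continuous fun z : (unitInterval × X) × Γ.Space => z.1.2.1 z.2 :=
          hev.comp (continuous_fst.snd.prodMk continuous_snd)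
        have h2 : Continuous fun z : (unitInterval × X) × Γ.Space =>
            position hΓ (x z.1.2) (h (0, z.1.2)) z.2 := hpos.comp (by fun_prop :
              Continuous fun z : (unitInterval × X) × Γ.Space =>
                (((0 : unitInterval), z.1.2), z.2))
        have h3 : Continuous fun z : (unitInterval × X) × Γ.Space => (z.1.1 : ℝ) := by fun_prop
        exact (((continuous_const.sub h3).mul h1.fst).add (h3.mul h2)).prodMk h1.snd⟩
  have hK₁ : ∀ z, Γ.IsProgressive b₀ b₁ (K₁ z) := fun ⟨t, F⟩ => by
    -- The heights are unchanged here, so the segment of heights is the trivial one from `F` to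
    -- itself; on each level the old and the standard positions are ordered alike.
    refine F.2.of_segment F.2 hΓ 0 (fun p => by simp [K₁]) fun p q hl he => ?_
    have he' : (F.1 p).2 = (F.1 q).2 := he
    have h1 : (F.1 p).1 < (F.1 q).1 := F.2.lt_of_leftOfPoint_right hl (.refl p) he'
    have h2 := hlt (0, F) p q hl (by rwa [h0, h0])
    change (1 - t : ℝ) * (F.1 p).1 + t * _ < (1 - t : ℝ) * (F.1 q).1 + t * _
    have h3 := t.2.1
    have h4 := t.2.2
    rcases h3.eq_or_lt with h3 | h3
    · rw [← h3]
      linarith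
    · nlinarith
  let H₁ : C(unitInterval × X, X) := ⟨fun z => ⟨K₁ z, hK₁ z⟩, K₁.continuous.subtype_mk _⟩
  let H₂ : C(unitInterval × X, X) := ⟨fun z => ⟨K₂ z, hK₂ z⟩, K₂.continuous.subtype_mk _⟩
  let m : C(X, X) := H₂.comp ⟨fun F => (0, F), by fun_prop⟩
  let r : C(X, X) := H₂.comp ⟨fun F => (1, F), by fun_prop⟩
  have hom₁ : (ContinuousMap.id X).Homotopic m := ⟨⟨H₁, fun F => ?_, fun F => ?_⟩⟩
  · have hom₂ : m.Homotopic r := ⟨⟨H₂, fun F => rfl, fun F => rfl⟩⟩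
    refine ⟨r, hom₁.trans hom₂, ?_⟩
    rw [IsLocallyConstant.iff_eventually_eq]
    intro F
    filter_upwards [(IsLocallyConstant.iff_eventually_eq _).1 hord F] with G hG
    have hb : base G = base F := congrArg (Function.invFun ord) hG
    -- At time `1` only the heights of the base remain, so the drawing depends on the order alone.
    have hh1 : h (1, G) = h (1, F) := funext fun p => by simp [h, hb]
    refine Subtype.ext (ContinuousMap.ext fun p => ?_)
    change (position hΓ (rank (ord G)) (h (1, G)) p, h (1, G) p) =
      (position hΓ (rank (ord F)) (h (1, F)) p, h (1, F) p)
    rw [hG, hh1]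
  · refine Subtype.ext (ContinuousMap.ext fun p => ?_)
    simp [H₁, K₁]
  · refine Subtype.ext (ContinuousMap.ext fun p => Prod.ext ?_ ?_)
    · simp [H₁, K₁, m, H₂, K₂]
    · simp [H₁, K₁, m, H₂, K₂, h0]

end BGraph

/-! ### Spaces whose identity is homotopic to a locally constant map -/

section Acyclic

variable {X : Type*} [TopologicalSpace X] {r : C(X, X)}

theorem ContinuousMap.Homotopic.joined {Y : Type*} [TopologicalSpace Y] {f g : C(X, Y)}
    (h : f.Homotopic g) (x : X) : Joined (f x) (g x) :=
  ⟨h.some.evalAt x⟩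

/-- A locally constant map is constant along paths, and the homotopy joins each point to its image.
-/
theorem joined_iff_of_homotopic (h : (ContinuousMap.id X).Homotopic r) (hr : IsLocallyConstant r)
    {x y : X} : Joined x y ↔ r x = r y := by
  refine ⟨fun ⟨γ⟩ => ?_, fun hxy => (h.joined x).trans ?_⟩
  · have := (hr.comp_continuous γ.continuous).apply_eq_of_preconnectedSpace 0 1
    simpa using this
  · rw [hxy]
    exact (h.joined y).symm

/-- A space whose identity is homotopic to a locally constant map is acyclic. -/
theorem isAcyclicSpace_of_homotopic (h : (ContinuousMap.id X).Homotopic r)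
    (hr : IsLocallyConstant r) : IsAcyclicSpace X := by
  have hd : DiscreteTopology (ZerothHomotopy X) := by
    rw [discreteTopology_iff_forall_isOpen]
    intro s
    rw [← ZerothHomotopy.isQuotientMap_mk.isOpen_preimage]
    convert hr (r '' (ZerothHomotopy.mk ⁻¹' s)) using 1
    ext x
    refine ⟨fun hx => ⟨x, hx, rfl⟩, ?_⟩
    rintro ⟨y, hy, hxy⟩
    have : ZerothHomotopy.mk y = ZerothHomotopy.mk x :=
      Quotient.sound ((joined_iff_of_homotopic h hr).2 hxy)
    change ZerothHomotopy.mk x ∈ s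
    exact this ▸ hy
  refine ⟨hd, ⟨⟨⟨ZerothHomotopy.mk, ZerothHomotopy.isQuotientMap_mk.continuous⟩,
    ⟨Quotient.lift r fun x y hxy => (joined_iff_of_homotopic h hr).1 hxy,
      continuous_of_discreteTopology⟩, ?_, ?_⟩, fun x => rfl⟩⟩
  · exact h.symm
  · convert ContinuousMap.Homotopic.refl _ using 1
    ext z
    induction z using Quotient.inductionOn with
    | h x => exact Quotient.sound (h.joined x)

/-- The homotopy moves each point within its path component, on which `r` is constant. -/
theorem contractibleSpace_of_homotopic (h : (ContinuousMap.id X).Homotopic r)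
    (hr : IsLocallyConstant r) {x : X} {P : X → Prop} (hP : ∀ y, P y ↔ Joined x y) :
    ContractibleSpace {y // P y} := by
  obtain ⟨H⟩ := h
  have hH : ∀ t y, Joined y (H (t, y)) := fun t y =>
    (joined_iff_of_homotopic ⟨H⟩ hr).2 (by
      have := (hr.comp_continuous (f := fun t => H (t, y))
        (by fun_prop)).apply_eq_of_preconnectedSpace 0 t
      simpa using this)
  have hrx : P (r x) := (hP _).2 (ContinuousMap.Homotopic.joined ⟨H⟩ x)
  refine contractible_iff_id_nullhomotopic _ |>.2 ⟨⟨r x, hrx⟩, ⟨⟨⟨fun z =>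
    ⟨H (z.1, z.2.1), (hP _).2 (((hP _).1 z.2.2).trans (hH _ _))⟩, by fun_prop⟩, ?_, ?_⟩⟩⟩
  · exact fun y => Subtype.ext (by simp)
  · intro y
    refine Subtype.ext ?_
    simpa using ((joined_iff_of_homotopic ⟨H⟩ hr).1 ((hP _).1 y.2)).symm

theorem exists_sigma_homotopic {ι : Type*} {X : ι → Type*} [∀ i, TopologicalSpace (X i)]
    (h : ∀ i, ∃ r : C(X i, X i), (ContinuousMap.id _).Homotopic r ∧ IsLocallyConstant r) :
    ∃ r : C(Σ i, X i, Σ i, X i), (ContinuousMap.id _).Homotopic r ∧ IsLocallyConstant r := by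
  choose r hH hr using h
  -- Viewed as a map into the path space, the combined homotopy can be checked for continuity on
  -- each summand.
  let K : (Σ i, X i) → C(unitInterval, Σ i, X i) := fun z =>
    ⟨fun t => ⟨z.1, (hH z.1).some (t, z.2)⟩, by
      exact continuous_sigmaMk.comp ((hH z.1).some.continuous.comp (by fun_prop))⟩
  have hK : Continuous K := continuous_sigma fun i =>
    ContinuousMap.continuous_of_continuous_uncurry _ (by
      exact continuous_sigmaMk.comp ((hH i).some.continuous.comp
        (by fun_prop : Continuous fun z : X i × unitInterval => (z.2, z.1))))
  refine ⟨⟨fun z => ⟨z.1, r z.1 z.2⟩, continuous_sigma fun i =>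
    continuous_sigmaMk.comp (r i).continuous⟩, ⟨⟨⟨fun z => K z.2 z.1, by fun_prop⟩, ?_, ?_⟩⟩, ?_⟩
  · rintro ⟨i, y⟩
    simp [K]
  · rintro ⟨i, y⟩
    simp [K]
  · intro s
    exact isOpen_sigma_iff.2 fun i => hr i (Sigma.mk i ⁻¹' s)

end Acyclic

/-! ### From plane graphs to diagrams -/

section

variable {C : Type u} [Category.{v} C] [SemimonoidalCategory C] {b₀ b₁ : ℝ}

/-- Along the deformation of plane graphs the edge order is locally constant in time, hence
constant, so diagrams stay diagrams and the homotopy restricts. -/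
theorem LabelledGraph.exists_homotopic_isLocallyConstant (G : LabelledGraph C)
    (hG : G.graph.Effective) (b₀ b₁ : ℝ) :
    ∃ r : C({f : C(G.graph.Space, ℝ × ℝ) // G.IsDiagram b₀ b₁ f},
      {f : C(G.graph.Space, ℝ × ℝ) // G.IsDiagram b₀ b₁ f}),
      (ContinuousMap.id _).Homotopic r ∧ IsLocallyConstant r := by
  obtain ⟨r, ⟨H⟩, hr⟩ :=
    BGraph.ProgressiveSpace.exists_homotopic_isLocallyConstant hG b₀ b₁
  let ι : {f : C(G.graph.Space, ℝ × ℝ) // G.IsDiagram b₀ b₁ f} →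
      G.graph.ProgressiveSpace b₀ b₁ := fun D => ⟨D.1, D.2.isProgressive⟩
  have hι : Continuous ι := continuous_subtype_val.subtype_mk _
  have hD : ∀ t D, G.IsDiagram b₀ b₁ (H (t, ι D)).1 := fun t D => by
    have : T2Space G.graph.Space := D.2.isProgressive.embedding.t2Space
    refine D.2.of_edgeOrder hG (H (t, ι D)).2 ?_
    have := ((BGraph.isLocallyConstant_edgeOrder hG).comp_continuous (f := fun t => H (t, ι D))
      (by fun_prop)).apply_eq_of_preconnectedSpace 0 t
    simpa [ι] using this
  have hD' : ∀ D, G.IsDiagram b₀ b₁ (r (ι D)).1 := fun D => by simpa using hD 1 D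
  refine ⟨⟨fun D => ⟨(r (ι D)).1, hD' D⟩, by fun_prop⟩,
    ⟨⟨⟨fun z => ⟨(H (z.1, ι z.2)).1, hD z.1 z.2⟩, by fun_prop⟩, ?_, ?_⟩⟩, ?_⟩
  · exact fun D => Subtype.ext (by simp [ι])
  · exact fun D => Subtype.ext (by simp)
  · rw [IsLocallyConstant.iff_eventually_eq]
    intro D
    filter_upwards [(IsLocallyConstant.iff_eventually_eq _).1 (hr.comp_continuous hι) D] with D' h
    exact Subtype.ext (congrArg (fun F => F.1) h)

/-- A path in a topological sum stays in one summand. Paths of maps and deformations correspond by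
currying, since a graph embedded in the plane is compact Hausdorff. -/
theorem deformationEquivalent_iff_joined {P : BGraph → Prop} {D D' : DiagramSpace C b₀ b₁ P} :
    DeformationEquivalent D D' ↔ Joined D D' := by
  constructor
  · rintro ⟨G, h, stage, rfl, rfl⟩
    exact ⟨⟨⟨fun t => ⟨G, h.curry t, stage t⟩,
      continuous_sigmaMk.comp (h.curry.continuous.subtype_mk _)⟩, rfl, rfl⟩⟩
  · rintro ⟨γ⟩
    obtain ⟨G, g, hg⟩ := γ.toContinuousMap.exists_lift_sigma
    by_cases hT : T2Space G.1.graph.Space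
    · let h : C(unitInterval × G.1.graph.Space, ℝ × ℝ) :=
        ⟨fun z => (g z.1).1 z.2, by fun_prop⟩
      have hh : ∀ t, h.curry t = (g t).1 := fun t => rfl
      refine ⟨G, h, fun t => (g t).2, ?_, ?_⟩
      · exact γ.source.symm.trans (DFunLike.congr_fun hg 0)
      · exact γ.target.symm.trans (DFunLike.congr_fun hg 1)
    · exact absurd (g 0).2.isProgressive.embedding.t2Space hT

theorem DiagramSpace.acyclic {P : BGraph → Prop} (hP : ∀ Γ, P Γ → Γ.Effective) (b₀ b₁ : ℝ) :
    IsAcyclicSpace (DiagramSpace C b₀ b₁ P) ∧ ∀ D : DiagramSpace C b₀ b₁ P,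
      ContractibleSpace {D' // DeformationEquivalent D D'} := by
  obtain ⟨r, h, hr⟩ := exists_sigma_homotopic fun G : {G : LabelledGraph C // P G.graph} =>
    G.1.exists_homotopic_isLocallyConstant (hP _ G.2) b₀ b₁
  exact ⟨isAcyclicSpace_of_homotopic h hr, fun D =>
    contractibleSpace_of_homotopic h hr fun _ => deformationEquivalent_iff_joined⟩

end

theorem mainTheorem2 (C : Type u) [Category.{v} C] [SemimonoidalCategory C]
    (b₀ b₁ : ℝ) (hb : b₀ < b₁) :
    (IsAcyclicSpace (DiagramSpace C b₀ b₁ BGraph.Effective) ∧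
      ∀ D : DiagramSpace C b₀ b₁ BGraph.Effective,
        ContractibleSpace {D' // DeformationEquivalent D D'}) ∧
    (IsAcyclicSpace (DiagramSpace C b₀ b₁ BGraph.TrainTrack) ∧
      ∀ D : DiagramSpace C b₀ b₁ BGraph.TrainTrack,
        ContractibleSpace {D' // DeformationEquivalent D D'}) :=
  ⟨DiagramSpace.acyclic (fun _ h => h) b₀ b₁,
    DiagramSpace.acyclic (fun _ h => h.effective) b₀ b₁⟩
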